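/- Let $(\Omega_1,\mu_1)$ and $(\Omega_2,\mu_2)$ be arbitrary probability spaces, and for $j=1,2$ let $W_j$ be a kernel on $\Omega_j$, i.e. a symmetric function $W_j:\Omega_j^2\to[0,\infty)$ that is measurable for the product $\sigma$-field and integrable with respect to $\mu_j\times\mu_j$. For an integrable function $F$ on $\Omega^2$, where $(\Omega,\mu)$ is a probability space, let the cut norm $\|F\|_\square$ be either $\sup_{S,T}\bigl|\int_{S\times T}F\,d(\mu\times\mu)\bigr|$, the supremum being over all measurable $S,T\subseteq\Omega$, or $\sup_{f,g}\bigl|\int_{\Omega^2}F(x,y)f(x)g(y)\,d\mu(x)\,d\mu(y)\bigr|$, the supremum being over all measurable $f,g:\Omega\to[-1,1]$; the theorem holds for each of the two versions. For a function $W$ on $\Omega'^2$ and a map $\varphi:\Omega\to\Omega'$, let $W^{\varphi}(x,y)=W(\varphi(x),\varphi(y))$ be the pull-back. Define $$\delta_\square(W_1,W_2)=\inf\,\bigl\|W_1^{\varphi_1}-W_2^{\varphi_2}\bigr\|_\square ,$$ the infimum being over all probability spaces $\Omega$ and all pairs of measure-preserving maps $\varphi_1:\Omega\to\Omega_1$,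 $\varphi_2:\Omega\to\Omega_2$. Then $\delta_\square(W_1,W_2)=0$ if and only if there exist a kernel $W$ on some probability space $(\Omega,\mu)$ and measure-preserving maps $\varphi_j:\Omega_j\to\Omega$ such that $W_j=W^{\varphi_j}$ $(\mu_j\times\mu_j)$-a.e. for $j=1,2$. When this holds, $\Omega$ can always be taken to be a Borel space, i.e. a measurable space isomorphic to a Borel subset of a Polish space. If moreover $\Omega_1$ and $\Omega_2$ are atomless (there is no measurable set $A$ of positive measure all of whose measurable subsets have measure $0$ or the measure of $A$), then one may take $\Omega=[0,1]$ with the Borel $\sigma$-field and Lebesgue measure. -/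

import Mathlib

open MeasureTheory

universe u v t w

noncomputable section

namespace CutMetric

/-- `W` is a kernel on the probability space `(Ω, μ)`: a measurable (for the product σ-field),
symmetric, integrable function `Ω² → [0, ∞)`. -/
structure IsKernel {Ω : Type u} [MeasurableSpace Ω] (μ : Measure Ω) (W : Ω × Ω → ℝ) : Prop where
  measurable : Measurable W
  symmetric : ∀ x y, W (x, y) = W (y, x)
  nonneg : ∀ p, 0 ≤ W p
  integrable : Integrable W (μ.prod μ)

/-- The pull-back `W^φ (x, y) = W (φ x, φ y)`. -/
def pullback {Ω : Type u} {Ω' : Type v} (W : Ω' × Ω' → ℝ) (φ : Ω → Ω') : Ω × Ω → ℝ :=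
  fun p => W (φ p.1, φ p.2)

/-- The cut norm in its version with sets: the supremum of `|∫_{S × T} F|` over all
measurable `S, T ⊆ Ω`. -/
def cutNormSets {Ω : Type u} [MeasurableSpace Ω] (μ : Measure Ω) (F : Ω × Ω → ℝ) : ℝ :=
  sSup {r : ℝ | ∃ S T : Set Ω, MeasurableSet S ∧ MeasurableSet T ∧
    r = |∫ p in S ×ˢ T, F p ∂(μ.prod μ)|}

/-- The cut norm in its version with functions: the supremum of `|∫ F(x,y) f(x) g(y)|` over all
measurable `f, g : Ω → [-1, 1]`. -/
def cutNormFuns {Ω : Type u} [MeasurableSpace Ω] (μ : Measure Ω) (F : Ω × Ω → ℝ) : ℝ :=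
  sSup {r : ℝ | ∃ f g : Ω → ℝ, Measurable f ∧ Measurable g ∧
    (∀ x, |f x| ≤ 1) ∧ (∀ x, |g x| ≤ 1) ∧
    r = |∫ p, F p * f p.1 * g p.2 ∂(μ.prod μ)|}

/-- The two customary versions of the cut norm. -/
inductive CutNormVersion
  | sets
  | funs

/-- The cut norm, in either version. -/
def cutNorm {Ω : Type u} [MeasurableSpace Ω] (ver : CutNormVersion) (μ : Measure Ω)
    (F : Ω × Ω → ℝ) : ℝ :=
  match ver with
  | .sets => cutNormSets μ F
  | .funs => cutNormFuns μ F

/-- The cut metric: the infimum of `‖W₁^φ₁ - W₂^φ₂‖` over all couplings, that is, over all pairs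
of measure-preserving maps `φ₁ : Ω → Ω₁`, `φ₂ : Ω → Ω₂` on a common probability space `Ω`.
The space `Ω` ranges over any fixed universe that contains `Ω₁ × Ω₂`. -/
def cutDist {Ω₁ : Type u} {Ω₂ : Type v} [MeasurableSpace Ω₁] [MeasurableSpace Ω₂]
    (ver : CutNormVersion) (μ₁ : Measure Ω₁) (μ₂ : Measure Ω₂)
    (W₁ : Ω₁ × Ω₁ → ℝ) (W₂ : Ω₂ × Ω₂ → ℝ) : ℝ :=
  sInf {d : ℝ | ∃ (Ω : Type (max u v t)) (_ : MeasurableSpace Ω) (μ : Measure Ω)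
    (φ₁ : Ω → Ω₁) (φ₂ : Ω → Ω₂), IsProbabilityMeasure μ ∧
    MeasurePreserving φ₁ μ μ₁ ∧ MeasurePreserving φ₂ μ μ₂ ∧
    d = cutNorm ver μ (pullback W₁ φ₁ - pullback W₂ φ₂)}

/-- An atom of a measure: a measurable set `A` of positive measure such that every measurable
subset of `A` has measure `0` or `μ A`. -/
def IsAtomSet {Ω : Type u} [MeasurableSpace Ω] (μ : Measure Ω) (A : Set Ω) : Prop :=
  MeasurableSet A ∧ 0 < μ A ∧ ∀ B ⊆ A, MeasurableSet B → μ B = 0 ∨ μ B = μ A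

/-- A measure is atomless if it has no atoms. -/
def IsAtomless {Ω : Type u} [MeasurableSpace Ω] (μ : Measure Ω) : Prop :=
  ∀ A : Set Ω, ¬ IsAtomSet μ A

/-- `W₁` and `W₂` are both a.e. equal to pull-backs of a single kernel `W` on `(Ω, μ)`, by
measure-preserving maps `φ₁ : Ω₁ → Ω` and `φ₂ : Ω₂ → Ω`. -/
def ArePullbacksOfKernelOn {Ω₁ : Type u} {Ω₂ : Type v} {Ω : Type w}
    [MeasurableSpace Ω₁] [MeasurableSpace Ω₂] [MeasurableSpace Ω]
    (μ₁ : Measure Ω₁) (μ₂ : Measure Ω₂) (W₁ : Ω₁ × Ω₁ → ℝ) (W₂ : Ω₂ × Ω₂ → ℝ)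
    (μ : Measure Ω) : Prop :=
  ∃ (W : Ω × Ω → ℝ) (φ₁ : Ω₁ → Ω) (φ₂ : Ω₂ → Ω), IsKernel μ W ∧
    MeasurePreserving φ₁ μ₁ μ ∧ MeasurePreserving φ₂ μ₂ μ ∧
    W₁ =ᵐ[μ₁.prod μ₁] pullback W φ₁ ∧ W₂ =ᵐ[μ₂.prod μ₂] pullback W φ₂

end CutMetric

end

noncomputable section

namespace CutMetric

/-! ### Kernels factor through the Cantor space -/

/-! Zero distance gives a common kernel. A measurable function on `Ω × Ω` involves only countably
many measurable subsets of `Ω`, so both kernels factor through the Cantor space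
(`IsKernel.exists_cantor`), and nearly optimal couplings push forward to couplings there. By
compactness these have a weak limit `ν` with the same marginals. Replacing `V₁`, `V₂` by continuous
functions costs an `L¹` error that depends on the marginals only, so integrals over clopen
rectangles pass to the limit. Hence `V₁(x, x') = V₂(y, y')` for almost all pairs of `ν`-points
(`exists_coupling_ae_eq`).

The common quotient records sections: `x` goes to the family of integrals of `V₁(x, ·)` over the
clopen sets. Under `ν` this family is a.e. a function of `y` alone, so the two sides have quotient
maps with the same law. The integrals determine almost every section, and a Radon–Nikodym argument,
applied once in each variable, turns this into a measurable kernel on the quotient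
(`exists_ae_eq_comp_prodMap_symm`).

Conversely, for arbitrary spaces over `Ω` the fibre product need not carry a coupling. Instead `W`
is approximated in `L¹` by a function of discrete classes, and `Ω₁`, `Ω₂` are coupled independently
within each class. The approximants then cancel, and the cut norm is at most the small `L¹` error.

For atomless spaces, the common standard Borel space is embedded in `ℝ`. There each map is a.e. the
quantile function of its law at a uniform variable (`IsAtomless.exists_uniform`). Both maps have the
same law, so one quantile function serves both sides. -/

lemma exists_common_refinement {Ω : Type*} [MeasurableSpace Ω] (ψ : ℕ → Ω → ℕ → Bool)
    (hψ : ∀ n, Measurable (ψ n)) :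
    ∃ χ : Ω → ℕ → Bool, Measurable χ ∧
      ∀ n, ∃ π : (ℕ → Bool) → ℕ → Bool, Measurable π ∧ ψ n = π ∘ χ := by
  refine ⟨fun x k => ψ k.unpair.1 x k.unpair.2, ?_, fun n => ?_⟩
  · exact measurable_pi_lambda _ fun k => (measurable_pi_apply _).comp (hψ _)
  · refine ⟨fun c m => c (Nat.pair n m), ?_, ?_⟩
    · exact measurable_pi_lambda _ fun k => measurable_pi_apply _
    · ext x m
      simp

lemma comap_prodMap_comp_le {Ω X Y : Type*} [MeasurableSpace X] [MeasurableSpace Y]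
    {π : X → Y} (hπ : Measurable π) (χ : Ω → X) :
    MeasurableSpace.comap (Prod.map (π ∘ χ) (π ∘ χ)) inferInstance ≤
      MeasurableSpace.comap (Prod.map χ χ) inferInstance := by
  rw [← Prod.map_comp_map, ← MeasurableSpace.comap_comp]
  exact MeasurableSpace.comap_mono (hπ.prodMap hπ).comap_le

/-- Induction on the generation of the product σ-field. A rectangle needs two bits, and a countable
union needs only a common refinement of countably many maps. -/
lemma exists_measurableSet_comap_prodMap {Ω : Type*} [MeasurableSpace Ω] {S : Set (Ω × Ω)}
    (hS : MeasurableSet S) : ∃ ψ : Ω → ℕ → Bool, Measurable ψ ∧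
      MeasurableSet[MeasurableSpace.comap (Prod.map ψ ψ) inferInstance] S := by
  classical
  rw [← generateFrom_prod] at hS
  induction S, hS using MeasurableSpace.generateFrom_induction with
  | hC S hS _ =>
    obtain ⟨A, hA, B, hB, rfl⟩ := hS
    have hA : MeasurableSet A := hA
    have hB : MeasurableSet B := hB
    refine ⟨fun x n => if n = 0 then decide (x ∈ A) else decide (x ∈ B), ?_, ?_⟩
    · refine measurable_pi_lambda _ fun n => ?_
      by_cases hn : n = 0
      · simpa [hn] using measurable_to_bool (by simpa [Set.preimage] using hA)
      · simpa [hn] using measurable_to_bool (by simpa [Set.preimage] using hB)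
    · refine ⟨{c | c 0 = true} ×ˢ {c | c 1 = true}, ?_, ?_⟩
      · exact (measurableSet_eq_fun (measurable_pi_apply 0) measurable_const).prod
          (measurableSet_eq_fun (measurable_pi_apply 1) measurable_const)
      · ext p
        simp
  | empty => exact ⟨fun _ _ => true, measurable_const, @MeasurableSet.empty _ (_)⟩
  | compl S _ ih =>
    obtain ⟨ψ, hψ, h⟩ := ih
    exact ⟨ψ, hψ, h.compl⟩
  | iUnion s _ ih =>
    choose ψ hψ h using ih
    obtain ⟨χ, hχ, hπ⟩ := exists_common_refinement ψ hψ
    refine ⟨χ, hχ, MeasurableSet.iUnion fun n => ?_⟩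
    obtain ⟨π, hm, he⟩ := hπ n
    have := h n
    rw [he] at this
    exact comap_prodMap_comp_le hm χ _ this

theorem exists_eq_pullback_cantor {Ω : Type*} [MeasurableSpace Ω] {W : Ω × Ω → ℝ}
    (hW : Measurable W) : ∃ (ψ : Ω → ℕ → Bool) (V : (ℕ → Bool) × (ℕ → Bool) → ℝ),
      Measurable ψ ∧ Measurable V ∧ W = pullback V ψ := by
  choose ψ hψ h using fun n => exists_measurableSet_comap_prodMap
    (hW (MeasurableSpace.measurableSet_natGeneratingSequence n))
  obtain ⟨χ, hχ, hπ⟩ := exists_common_refinement ψ hψ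
  have : Measurable[MeasurableSpace.comap (Prod.map χ χ) inferInstance] W := by
    rw [← MeasurableSpace.generateFrom_natGeneratingSequence ℝ]
    refine @measurable_generateFrom _ _ (_) _ _ ?_
    rintro _ ⟨n, rfl⟩
    obtain ⟨π, hm, he⟩ := hπ n
    have := h n
    rw [he] at this
    exact comap_prodMap_comp_le hm χ _ this
  obtain ⟨V, hV, rfl⟩ := this.exists_eq_measurable_comp
  exact ⟨χ, V, hχ, hV, rfl⟩

/-- A kernel is everywhere the pull-back of a kernel on the Cantor space. -/
theorem IsKernel.exists_cantor {Ω : Type*} [MeasurableSpace Ω] {μ : Measure Ω}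
    [IsProbabilityMeasure μ] {W : Ω × Ω → ℝ} (hW : IsKernel μ W) :
    ∃ (ψ : Ω → ℕ → Bool) (V : (ℕ → Bool) × (ℕ → Bool) → ℝ),
      Measurable ψ ∧ IsKernel (μ.map ψ) V ∧ W = pullback V ψ := by
  obtain ⟨ψ, V, hψ, hV, rfl⟩ := exists_eq_pullback_cantor hW.measurable
  -- The factorization fixes `V` only on pairs from the range of `ψ`. Symmetrising and taking
  -- absolute values makes it a kernel everywhere and keeps the pull-back, because `W` is itself
  -- symmetric and nonnegative.
  have hsymm : Measurable fun p => |V p + V p.swap| / 2 := by fun_prop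
  have he : pullback V ψ = pullback (fun p => |V p + V p.swap| / 2) ψ := by
    ext p
    have h1 : V (ψ p.2, ψ p.1) = V (ψ p.1, ψ p.2) := hW.symmetric p.2 p.1
    have h2 : 0 ≤ V (ψ p.1, ψ p.2) := hW.nonneg p
    simp only [pullback, Prod.swap_prod_mk, h1]
    rw [abs_of_nonneg (by positivity), add_self_div_two]
  refine ⟨ψ, _, hψ, ⟨hsymm, fun x y => by simp [add_comm], fun p => by positivity, ?_⟩, he⟩
  rw [Measure.map_prod_map _ _ hψ hψ, integrable_map_measure hsymm.aestronglyMeasurable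
    (by fun_prop)]
  have := hW.integrable
  rw [he] at this
  exact this

/-! ### Cut norms -/

lemma IsKernel.integrable_pullback {Ω Ω' : Type*} [MeasurableSpace Ω] [MeasurableSpace Ω']
    {μ : Measure Ω} {μ' : Measure Ω'} [IsProbabilityMeasure μ] [IsProbabilityMeasure μ']
    {W : Ω' × Ω' → ℝ} {φ : Ω → Ω'} (hW : IsKernel μ' W) (hφ : MeasurePreserving φ μ μ') :
    Integrable (pullback W φ) (μ.prod μ) :=
  (hφ.prod hφ).integrable_comp_of_integrable hW.integrable

lemma integral_prod_pullback {Ω Ω' : Type*} [MeasurableSpace Ω] [MeasurableSpace Ω']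
    {μ : Measure Ω} {μ' : Measure Ω'} [IsProbabilityMeasure μ] [IsProbabilityMeasure μ']
    {W : Ω' × Ω' → ℝ} {φ : Ω → Ω'} (hφ : MeasurePreserving φ μ μ')
    (hW : AEStronglyMeasurable W (μ'.prod μ')) :
    ∫ p, pullback W φ p ∂(μ.prod μ) = ∫ p, W p ∂(μ'.prod μ') := by
  have h := hφ.prod hφ
  rw [← h.map_eq] at hW ⊢
  rw [integral_map h.measurable.aemeasurable hW]
  rfl

lemma abs_indicator_one_le {Ω : Type*} (S : Set Ω) (x : Ω) : |S.indicator (1 : Ω → ℝ) x| ≤ 1 := by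
  by_cases h : x ∈ S <;> simp [h]

section CutNorm

variable {Ω : Type*} [MeasurableSpace Ω] {μ : Measure Ω} {F : Ω × Ω → ℝ}

lemma abs_integral_mul_mul_le (hF : Integrable F (μ.prod μ)) {f g : Ω → ℝ}
    (hf : ∀ x, |f x| ≤ 1) (hg : ∀ x, |g x| ≤ 1) :
    |∫ p, F p * f p.1 * g p.2 ∂(μ.prod μ)| ≤ ∫ p, |F p| ∂(μ.prod μ) := by
  rw [← Real.norm_eq_abs]
  refine norm_integral_le_of_norm_le hF.abs (.of_forall fun p => ?_)
  rw [Real.norm_eq_abs, abs_mul, abs_mul, mul_assoc]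
  exact mul_le_of_le_one_right (abs_nonneg _)
    (mul_le_one₀ (hf _) (abs_nonneg _) (hg _))

lemma setIntegral_prod_eq_integral_indicator {S T : Set Ω} (hS : MeasurableSet S)
    (hT : MeasurableSet T) :
    ∫ p in S ×ˢ T, F p ∂(μ.prod μ) =
      ∫ p, F p * S.indicator 1 p.1 * T.indicator 1 p.2 ∂(μ.prod μ) := by
  rw [← integral_indicator (hS.prod hT)]
  congr 1 with p
  by_cases h1 : p.1 ∈ S <;> by_cases h2 : p.2 ∈ T <;> simp [Set.indicator, h1, h2]

lemma cutNorm_nonneg (ver : CutNormVersion) : 0 ≤ cutNorm ver μ F := by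
  cases ver
  · refine Real.sSup_nonneg ?_
    rintro _ ⟨S, T, _, _, rfl⟩
    positivity
  · refine Real.sSup_nonneg ?_
    rintro _ ⟨S, T, _, _, _, _, rfl⟩
    positivity

lemma cutNorm_le_integral_abs (hF : Integrable F (μ.prod μ)) (ver : CutNormVersion) :
    cutNorm ver μ F ≤ ∫ p, |F p| ∂(μ.prod μ) := by
  cases ver
  · refine Real.sSup_le ?_ (by positivity)
    rintro _ ⟨S, T, hS, hT, rfl⟩
    rw [setIntegral_prod_eq_integral_indicator hS hT]
    exact abs_integral_mul_mul_le hF (abs_indicator_one_le S) (abs_indicator_one_le T)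
  · refine Real.sSup_le ?_ (by positivity)
    rintro _ ⟨f, g, _, _, hf, hg, rfl⟩
    exact abs_integral_mul_mul_le hF hf hg

/-- The forward direction uses nothing else about the cut norm, so both versions are treated at
once. Integrability is what bounds the supremum. -/
lemma abs_setIntegral_prod_le_cutNorm (hF : Integrable F (μ.prod μ)) (ver : CutNormVersion)
    {S T : Set Ω} (hS : MeasurableSet S) (hT : MeasurableSet T) :
    |∫ p in S ×ˢ T, F p ∂(μ.prod μ)| ≤ cutNorm ver μ F := by
  cases ver
  · refine le_csSup ⟨∫ p, |F p| ∂(μ.prod μ), ?_⟩ ⟨S, T, hS, hT, rfl⟩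
    rintro _ ⟨S, T, hS, hT, rfl⟩
    rw [setIntegral_prod_eq_integral_indicator hS hT]
    exact abs_integral_mul_mul_le hF (abs_indicator_one_le S) (abs_indicator_one_le T)
  · refine le_csSup ⟨∫ p, |F p| ∂(μ.prod μ), ?_⟩ ⟨S.indicator 1, T.indicator 1,
      measurable_one.indicator hS, measurable_one.indicator hT, abs_indicator_one_le S,
      abs_indicator_one_le T, by rw [setIntegral_prod_eq_integral_indicator hS hT]⟩
    rintro _ ⟨f, g, _, _, hf, hg, rfl⟩
    exact abs_integral_mul_mul_le hF hf hg

end CutNorm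

/-- Moves a coupling on `Ω₁ × Ω₂` into the universe over which the infimum in `cutDist` is taken. -/
lemma measurePreserving_ulift {α : Type*} [MeasurableSpace α] (m : Measure α) :
    MeasurePreserving (MeasurableEquiv.ulift : ULift.{w} α ≃ᵐ α)
      (m.map (MeasurableEquiv.ulift : ULift.{w} α ≃ᵐ α).symm) m :=
  MeasurePreserving.symm (MeasurableEquiv.ulift : ULift.{w} α ≃ᵐ α).symm
    ((MeasurableEquiv.measurable _).measurePreserving _)

/-- The difference of the two pull-backs of `V₁` and `V₂` to `X × Y`. -/
def couplingDiff {X Y : Type*} (V₁ : X × X → ℝ) (V₂ : Y × Y → ℝ) : (X × Y) × (X × Y) → ℝ :=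
  pullback V₁ Prod.fst - pullback V₂ Prod.snd

/-- If the cut distance is zero, then there are couplings that are almost optimal for the cut
norm, transported along measurable maps through which the kernels factor. -/
theorem exists_coupling_of_cutDist_eq_zero {Ω₁ : Type u} {Ω₂ : Type v} {X Y : Type*}
    [MeasurableSpace Ω₁] [MeasurableSpace Ω₂] [MeasurableSpace X] [MeasurableSpace Y]
    {μ₁ : Measure Ω₁} {μ₂ : Measure Ω₂} [IsProbabilityMeasure μ₁] [IsProbabilityMeasure μ₂]
    {V₁ : X × X → ℝ} {V₂ : Y × Y → ℝ} {ψ₁ : Ω₁ → X} {ψ₂ : Ω₂ → Y}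
    (hψ₁ : Measurable ψ₁) (hψ₂ : Measurable ψ₂)
    (hV₁ : IsKernel (μ₁.map ψ₁) V₁) (hV₂ : IsKernel (μ₂.map ψ₂) V₂) {ver : CutNormVersion}
    (h : cutDist.{u, v, t} ver μ₁ μ₂ (pullback V₁ ψ₁) (pullback V₂ ψ₂) = 0)
    {ε : ℝ} (hε : 0 < ε) :
    ∃ ν : Measure (X × Y), IsProbabilityMeasure ν ∧ ν.fst = μ₁.map ψ₁ ∧ ν.snd = μ₂.map ψ₂ ∧
      ∀ S T, MeasurableSet S → MeasurableSet T →
        |∫ p in S ×ˢ T, couplingDiff V₁ V₂ p ∂(ν.prod ν)| ≤ ε := by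
  rw [cutDist] at h
  obtain ⟨d, ⟨Ω, _, μ, φ₁, φ₂, _, h₁, h₂, rfl⟩, hd⟩ : ∃ d ∈ {d : ℝ |
      ∃ (Ω : Type (max u v t)) (_ : MeasurableSpace Ω) (μ : Measure Ω)
      (φ₁ : Ω → Ω₁) (φ₂ : Ω → Ω₂), IsProbabilityMeasure μ ∧
      MeasurePreserving φ₁ μ μ₁ ∧ MeasurePreserving φ₂ μ μ₂ ∧
      d = cutNorm ver μ (pullback (pullback V₁ ψ₁) φ₁ - pullback (pullback V₂ ψ₂) φ₂)}, d < ε := by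
    -- The independent coupling shows that the set of distances is nonempty; otherwise its `sInf`
    -- would be `0` by convention.
    refine exists_lt_of_csInf_lt ⟨_, ULift.{max u v t} (Ω₁ × Ω₂), inferInstance,
      (μ₁.prod μ₂).map MeasurableEquiv.ulift.symm, Prod.fst ∘ MeasurableEquiv.ulift,
      Prod.snd ∘ MeasurableEquiv.ulift, ?_, ?_, ?_, rfl⟩ (by rw [h]; exact hε)
    · exact Measure.isProbabilityMeasure_map (MeasurableEquiv.measurable _).aemeasurable
    · exact measurePreserving_fst.comp (measurePreserving_ulift _)
    · exact measurePreserving_snd.comp (measurePreserving_ulift _)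
  have k₁ := (hψ₁.measurePreserving μ₁).comp h₁
  have k₂ := (hψ₂.measurePreserving μ₂).comp h₂
  have : IsProbabilityMeasure (μ₁.map ψ₁) := Measure.isProbabilityMeasure_map hψ₁.aemeasurable
  have : IsProbabilityMeasure (μ₂.map ψ₂) := Measure.isProbabilityMeasure_map hψ₂.aemeasurable
  let θ : Ω → X × Y := fun x => ((ψ₁ ∘ φ₁) x, (ψ₂ ∘ φ₂) x)
  have hθm : Measurable θ := k₁.measurable.prodMk k₂.measurable
  have : IsProbabilityMeasure (μ.map θ) := Measure.isProbabilityMeasure_map hθm.aemeasurable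
  refine ⟨μ.map θ, this, ?_, ?_, fun S T hS hT => ?_⟩
  · exact (Measure.fst_map_prodMk k₂.measurable).trans k₁.map_eq
  · exact (Measure.snd_map_prodMk k₁.measurable).trans k₂.map_eq
  · have hF : Integrable (pullback V₁ (ψ₁ ∘ φ₁) - pullback V₂ (ψ₂ ∘ φ₂)) (μ.prod μ) :=
      (hV₁.integrable_pullback k₁).sub (hV₂.integrable_pullback k₂)
    have hle := abs_setIntegral_prod_le_cutNorm hF ver (hθm hS) (hθm hT)
    refine le_trans (le_of_eq ?_) (hle.trans hd.le)
    have hm : Measurable (couplingDiff V₁ V₂) := by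
      have := hV₁.measurable
      have := hV₂.measurable
      unfold couplingDiff pullback
      fun_prop
    rw [Measure.map_prod_map _ _ hθm hθm, setIntegral_map (hS.prod hT) hm.aestronglyMeasurable
      (by fun_prop)]
    rfl

/-! ### The infimum over couplings is attained on the Cantor space -/

section Compactness

open Filter Topology

/-- Each kernel depends on one coordinate of the coupling only, so the error is governed by the
marginals and is uniform over all couplings of them. -/
lemma abs_setIntegral_couplingDiff_sub_le {X Y : Type*} [MeasurableSpace X] [MeasurableSpace Y]
    {ν : Measure (X × Y)} [IsProbabilityMeasure ν] {V₁ U₁ : X × X → ℝ} {V₂ U₂ : Y × Y → ℝ}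
    (hV₁ : Integrable V₁ (ν.fst.prod ν.fst)) (hU₁ : Integrable U₁ (ν.fst.prod ν.fst))
    (hV₂ : Integrable V₂ (ν.snd.prod ν.snd)) (hU₂ : Integrable U₂ (ν.snd.prod ν.snd))
    {ε : ℝ} (h₁ : ∫ p, |V₁ p - U₁ p| ∂(ν.fst.prod ν.fst) ≤ ε)
    (h₂ : ∫ p, |V₂ p - U₂ p| ∂(ν.snd.prod ν.snd) ≤ ε) (R : Set ((X × Y) × (X × Y))) :
    |(∫ p in R, couplingDiff V₁ V₂ p ∂(ν.prod ν)) - ∫ p in R, couplingDiff U₁ U₂ p ∂(ν.prod ν)|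
      ≤ 2 * ε := by
  have k₁ : MeasurePreserving (Prod.fst : X × Y → X) ν ν.fst := ⟨measurable_fst, rfl⟩
  have k₂ : MeasurePreserving (Prod.snd : X × Y → Y) ν ν.snd := ⟨measurable_snd, rfl⟩
  have iV₁ : Integrable (pullback V₁ Prod.fst) (ν.prod ν) :=
    (k₁.prod k₁).integrable_comp_of_integrable hV₁
  have iU₁ : Integrable (pullback U₁ Prod.fst) (ν.prod ν) :=
    (k₁.prod k₁).integrable_comp_of_integrable hU₁
  have iV₂ : Integrable (pullback V₂ Prod.snd) (ν.prod ν) :=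
    (k₂.prod k₂).integrable_comp_of_integrable hV₂
  have iU₂ : Integrable (pullback U₂ Prod.snd) (ν.prod ν) :=
    (k₂.prod k₂).integrable_comp_of_integrable hU₂
  have e₁ : ∫ p, |pullback V₁ Prod.fst p - pullback U₁ Prod.fst p| ∂(ν.prod ν) ≤ ε := by
    exact (integral_prod_pullback k₁ (hV₁.sub hU₁).abs.aestronglyMeasurable).trans_le h₁
  have e₂ : ∫ p, |pullback V₂ Prod.snd p - pullback U₂ Prod.snd p| ∂(ν.prod ν) ≤ ε := by
    exact (integral_prod_pullback k₂ (hV₂.sub hU₂).abs.aestronglyMeasurable).trans_le h₂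
  have iV : Integrable (couplingDiff V₁ V₂) (ν.prod ν) := iV₁.sub iV₂
  have iU : Integrable (couplingDiff U₁ U₂) (ν.prod ν) := iU₁.sub iU₂
  rw [← integral_sub iV.integrableOn iU.integrableOn]
  calc |∫ p in R, couplingDiff V₁ V₂ p - couplingDiff U₁ U₂ p ∂(ν.prod ν)|
      ≤ ∫ p in R, |couplingDiff V₁ V₂ p - couplingDiff U₁ U₂ p| ∂(ν.prod ν) :=
        abs_integral_le_integral_abs
    _ ≤ ∫ p, |couplingDiff V₁ V₂ p - couplingDiff U₁ U₂ p| ∂(ν.prod ν) :=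
        setIntegral_le_integral (iV.sub iU).abs (.of_forall fun _ => abs_nonneg _)
    _ ≤ ∫ p, (|pullback V₁ Prod.fst p - pullback U₁ Prod.fst p| +
          |pullback V₂ Prod.snd p - pullback U₂ Prod.snd p|) ∂(ν.prod ν) := by
        refine integral_mono (iV.sub iU).abs ((iV₁.sub iU₁).abs.add (iV₂.sub iU₂).abs) fun p => ?_
        simp only [couplingDiff, Pi.sub_apply]
        rw [sub_sub_sub_comm]
        exact abs_sub _ _
    _ ≤ 2 * ε := by
        refine (integral_add (iV₁.sub iU₁).abs (iV₂.sub iU₂).abs).trans_le ?_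
        simp only [Pi.sub_apply]
        linarith

/-- The integral over a clopen set of the difference of two continuous kernels depends
continuously on the coupling. -/
lemma tendsto_setIntegral_couplingDiff {X Y ι : Type*} [TopologicalSpace X] [TopologicalSpace Y]
    [MeasurableSpace X] [MeasurableSpace Y] [TopologicalSpace.PseudoMetrizableSpace X]
    [TopologicalSpace.PseudoMetrizableSpace Y] [SecondCountableTopology X]
    [SecondCountableTopology Y] [BorelSpace X] [BorelSpace Y] {l : Filter ι}
    {N : ι → ProbabilityMeasure (X × Y)} {ν : ProbabilityMeasure (X × Y)}
    (hN : Tendsto N l (𝓝 ν)) (U₁ : BoundedContinuousFunction (X × X) ℝ)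
    (U₂ : BoundedContinuousFunction (Y × Y) ℝ) {R : Set ((X × Y) × (X × Y))} (hR : IsClopen R) :
    Tendsto (fun i => ∫ p in R, couplingDiff U₁ U₂ p ∂((N i : Measure (X × Y)).prod (N i))) l
      (𝓝 (∫ p in R, couplingDiff U₁ U₂ p ∂((ν : Measure (X × Y)).prod ν))) := by
  have hc : Continuous fun p : (X × Y) × (X × Y) => couplingDiff U₁ U₂ p := by
    unfold couplingDiff pullback
    simp only [Pi.sub_def]
    fun_prop
  let f : BoundedContinuousFunction ((X × Y) × (X × Y)) ℝ :=
    BoundedContinuousFunction.ofNormedAddCommGroup (R.indicator (couplingDiff U₁ U₂))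
      (hR.continuous_indicator hc) (‖U₁‖ + ‖U₂‖) fun p => by
        refine (norm_indicator_le_norm_self _ _).trans ?_
        exact (norm_sub_le _ _).trans (add_le_add (U₁.norm_coe_le_norm _) (U₂.norm_coe_le_norm _))
  have hlim := ProbabilityMeasure.tendsto_iff_forall_integral_tendsto.1
    ((ProbabilityMeasure.continuous_prod.tendsto (ν, ν)).comp (hN.prodMk_nhds hN)) f
  have he : ∀ m : Measure ((X × Y) × (X × Y)),
      ∫ p in R, couplingDiff U₁ U₂ p ∂m = ∫ p, f p ∂m := fun m =>
    (integral_indicator hR.isOpen.measurableSet).symm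
  simp only [he]
  exact hlim

/-- Clopen sets form a π-system generating the Borel σ-field. Nonnegativity makes the two functions
densities of finite measures, which agree as soon as they agree on clopen rectangles. -/
lemma ae_eq_of_forall_isClopen_setIntegral_eq {Z : Type*} [TopologicalSpace Z]
    [T2Space Z] [CompactSpace Z] [TotallyDisconnectedSpace Z] [SecondCountableTopology Z]
    [MeasurableSpace Z] [BorelSpace Z] {m : Measure (Z × Z)}
    {F G : Z × Z → ℝ} (hF : Integrable F m) (hG : Integrable G m) (hF0 : 0 ≤ F) (hG0 : 0 ≤ G)
    (h : ∀ S T, IsClopen S → IsClopen T → ∫ p in S ×ˢ T, F p ∂m = ∫ p in S ×ˢ T, G p ∂m) :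
    F =ᵐ[m] G := by
  have hgen : (inferInstance : MeasurableSpace Z) =
      MeasurableSpace.generateFrom {S : Set Z | IsClopen S} := by
    rw [BorelSpace.measurable_eq (α := Z)]
    exact loc_compact_Haus_tot_disc_of_zero_dim.borel_eq_generateFrom
  have hpi : IsPiSystem {S : Set Z | IsClopen S} := fun S hS T hT _ => IsClopen.inter hS hT
  have hspan : IsCountablySpanning {S : Set Z | IsClopen S} :=
    ⟨fun _ => Set.univ, fun _ => isClopen_univ, Set.iUnion_const _⟩
  have hrect : ∀ S T, IsClopen S → IsClopen T →
      ∫⁻ p in S ×ˢ T, ENNReal.ofReal (F p) ∂m = ∫⁻ p in S ×ˢ T, ENNReal.ofReal (G p) ∂m := by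
    intro S T hS hT
    rw [← ofReal_integral_eq_lintegral_ofReal hF.integrableOn (.of_forall hF0),
      ← ofReal_integral_eq_lintegral_ofReal hG.integrableOn (.of_forall hG0), h S T hS hT]
  have hfin : ∫⁻ p, ENNReal.ofReal (F p) ∂m ≠ ⊤ := hF.lintegral_lt_top.ne
  have hfm : IsFiniteMeasure (m.withDensity fun p => ENNReal.ofReal (F p)) :=
    isFiniteMeasure_withDensity hfin
  have key : m.withDensity (fun p => ENNReal.ofReal (F p)) =
      m.withDensity (fun p => ENNReal.ofReal (G p)) := by
    refine ext_of_generate_finite _ (generateFrom_eq_prod hgen.symm hgen.symm hspan hspan).symm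
      (hpi.prod hpi) ?_ ?_
    · rintro _ ⟨S, hS, T, hT, rfl⟩
      have hm : MeasurableSet (S ×ˢ T) :=
        (IsClopen.isOpen hS).measurableSet.prod (IsClopen.isOpen hT).measurableSet
      rw [withDensity_apply _ hm, withDensity_apply _ hm, hrect S T hS hT]
    · rw [withDensity_apply _ .univ, withDensity_apply _ .univ, ← Set.univ_prod_univ,
        hrect _ _ isClopen_univ isClopen_univ]
  rw [withDensity_eq_iff hF.aemeasurable.ennreal_ofReal hG.aemeasurable.ennreal_ofReal hfin] at key
  filter_upwards [key] with p hp
  exact (ENNReal.ofReal_eq_ofReal_iff (hF0 p) (hG0 p)).1 hp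

lemma map_eq_of_tendsto {Z X ι : Type*} [TopologicalSpace Z] [MeasurableSpace Z]
    [OpensMeasurableSpace Z] [TopologicalSpace X] [MeasurableSpace X] [BorelSpace X]
    [HasOuterApproxClosed X] {l : Filter ι} [l.NeBot] {N : ι → ProbabilityMeasure Z}
    {ν : ProbabilityMeasure Z} (hN : Tendsto N l (𝓝 ν)) {f : Z → X} (hf : Continuous f)
    {m : Measure X} [hm : IsProbabilityMeasure m] (h : ∀ i, (N i : Measure Z).map f = m) :
    (ν : Measure Z).map f = m := by
  have h1 := ((ProbabilityMeasure.continuous_map hf).tendsto ν).comp hN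
  let m' : ProbabilityMeasure X := ⟨m, hm⟩
  have h2 : Tendsto (fun _ : ι => m') l (𝓝 (ν.map hf.measurable.aemeasurable)) :=
    h1.congr fun n => Subtype.ext (h n)
  have h3 : ν.map hf.measurable.aemeasurable = m' := tendsto_nhds_unique h2 tendsto_const_nhds
  exact congrArg Subtype.val h3

theorem exists_coupling_ae_eq {m₁ m₂ : Measure (ℕ → Bool)} [IsProbabilityMeasure m₁]
    [IsProbabilityMeasure m₂] {V₁ V₂ : (ℕ → Bool) × (ℕ → Bool) → ℝ} (hV₁ : IsKernel m₁ V₁)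
    (hV₂ : IsKernel m₂ V₂)
    (h : ∀ ε : ℝ, 0 < ε → ∃ ν : Measure ((ℕ → Bool) × (ℕ → Bool)),
      IsProbabilityMeasure ν ∧ ν.fst = m₁ ∧ ν.snd = m₂ ∧
      ∀ S T, MeasurableSet S → MeasurableSet T →
        |∫ p in S ×ˢ T, couplingDiff V₁ V₂ p ∂(ν.prod ν)| ≤ ε) :
    ∃ ν : Measure ((ℕ → Bool) × (ℕ → Bool)), IsProbabilityMeasure ν ∧ ν.fst = m₁ ∧ ν.snd = m₂ ∧
      pullback V₁ Prod.fst =ᵐ[ν.prod ν] pullback V₂ Prod.snd := by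
  choose ρ hρ hfst hsnd hle using fun n : ℕ => h (1 / (n + 1)) (by positivity)
  let N : ℕ → ProbabilityMeasure ((ℕ → Bool) × (ℕ → Bool)) := fun n => ⟨ρ n, hρ n⟩
  -- Probability measures on a compact metrizable space form a compact space, so the limit along an
  -- ultrafilter exists and no subsequence has to be extracted.
  let l : Ultrafilter ℕ := hyperfilter ℕ
  let ν := (l.map N).lim
  have hN : Tendsto N l (𝓝 ν) := (l.map N).le_nhds_lim
  have hl : (l : Filter ℕ) ≤ atTop := Nat.hyperfilter_le_atTop
  have νfst : (ν : Measure ((ℕ → Bool) × (ℕ → Bool))).fst = m₁ :=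
    map_eq_of_tendsto hN continuous_fst hfst
  have νsnd : (ν : Measure ((ℕ → Bool) × (ℕ → Bool))).snd = m₂ :=
    map_eq_of_tendsto hN continuous_snd hsnd
  have i₁ : Integrable (pullback V₁ Prod.fst) ((ν : Measure ((ℕ → Bool) × (ℕ → Bool))).prod ν) :=
    hV₁.integrable_pullback ⟨measurable_fst, νfst⟩
  have i₂ : Integrable (pullback V₂ Prod.snd) ((ν : Measure ((ℕ → Bool) × (ℕ → Bool))).prod ν) :=
    hV₂.integrable_pullback ⟨measurable_snd, νsnd⟩
  refine ⟨ν, inferInstance, νfst, νsnd, ae_eq_of_forall_isClopen_setIntegral_eq i₁ i₂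
    (fun p => hV₁.nonneg _) (fun p => hV₂.nonneg _) fun S T hS hT => ?_⟩
  rw [← sub_eq_zero, ← integral_sub i₁.integrableOn i₂.integrableOn, ← abs_eq_zero]
  refine le_antisymm (le_of_forall_pos_le_add fun ε hε => ?_) (abs_nonneg _)
  -- Each exchange of `V` for `U` costs `2 * (ε / 8)`. Along the sequence this gives `ε / 4 + ε / 8
  -- ≤ ε / 2` for `U`, and in the limit `ε / 2 + ε / 4 ≤ ε` for `V`.
  obtain ⟨U₁, hU₁, iU₁⟩ := hV₁.integrable.exists_boundedContinuous_integral_sub_le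
    (show 0 < ε / 8 by positivity)
  obtain ⟨U₂, hU₂, iU₂⟩ := hV₂.integrable.exists_boundedContinuous_integral_sub_le
    (show 0 < ε / 8 by positivity)
  simp only [Real.norm_eq_abs] at hU₁ hU₂
  have bound : ∀ m : ProbabilityMeasure ((ℕ → Bool) × (ℕ → Bool)), (m : Measure ((ℕ → Bool) × (ℕ → Bool))).fst = m₁ →
      (m : Measure ((ℕ → Bool) × (ℕ → Bool))).snd = m₂ →
      |(∫ p in S ×ˢ T, couplingDiff V₁ V₂ p ∂((m : Measure ((ℕ → Bool) × (ℕ → Bool))).prod m)) -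
        ∫ p in S ×ˢ T, couplingDiff U₁ U₂ p ∂((m : Measure ((ℕ → Bool) × (ℕ → Bool))).prod m)| ≤ 2 * (ε / 8) := by
    rintro m rfl rfl
    exact abs_setIntegral_couplingDiff_sub_le hV₁.integrable iU₁ hV₂.integrable iU₂ hU₁ hU₂ _
  have hlim := tendsto_setIntegral_couplingDiff hN U₁ U₂ (hS.prod hT)
  have hev : ∀ᶠ n in (l : Filter ℕ),
      |∫ p in S ×ˢ T, couplingDiff U₁ U₂ p ∂((N n : Measure ((ℕ → Bool) × (ℕ → Bool))).prod (N n))| ≤ ε / 2 := by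
    have h0 : ∀ᶠ n : ℕ in (l : Filter ℕ), 1 / ((n : ℝ) + 1) < ε / 8 :=
      (tendsto_one_div_add_atTop_nhds_zero_nat.mono_left hl).eventually
        (gt_mem_nhds (by positivity))
    filter_upwards [h0] with n hn
    have h1 := bound (N n) (hfst n) (hsnd n)
    have h2 := hle n S T hS.isOpen.measurableSet hT.isOpen.measurableSet
    change |∫ p in S ×ˢ T, couplingDiff V₁ V₂ p ∂((N n : Measure ((ℕ → Bool) × (ℕ → Bool))).prod (N n))| ≤ _ at h2
    rw [abs_le] at h1 h2 ⊢
    constructor <;> linarith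
  have hU := le_of_tendsto hlim.abs hev
  have h1 := bound ν νfst νsnd
  change |∫ p in S ×ˢ T, couplingDiff V₁ V₂ p ∂((ν : Measure ((ℕ → Bool) × (ℕ → Bool))).prod ν)| ≤ _
  rw [abs_le] at h1 hU ⊢
  constructor <;> linarith

end Compactness

/-! ### Factoring a kernel through its sections -/

section Factor

open scoped ENNReal

variable {X X' Y : Type*} [MeasurableSpace X] [MeasurableSpace X'] [MeasurableSpace Y]

/-- A function on `X × Y` is a.e. a function of `(φ x, y)` if its integrals over the sets of a
generating π-system of `Y` are a.e. functions of `φ x`. -/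
theorem exists_ae_eq_comp_prodMap {μ : Measure X} {m : Measure Y} [IsProbabilityMeasure μ]
    [IsProbabilityMeasure m] {φ : X → X'} (hφ : Measurable φ) {H : X × Y → ℝ≥0∞}
    (hH : Measurable H) (hfin : ∫⁻ p, H p ∂(μ.prod m) ≠ ∞) {C : Set (Set Y)}
    (hC : (inferInstance : MeasurableSpace Y) = MeasurableSpace.generateFrom C)
    (hpi : IsPiSystem C) (huniv : Set.univ ∈ C)
    (h : ∀ E ∈ C, ∃ g : X' → ℝ≥0∞, Measurable g ∧
      (fun x => ∫⁻ y in E, H (x, y) ∂m) =ᵐ[μ] g ∘ φ) :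
    ∃ K : X' × Y → ℝ≥0∞, Measurable K ∧ H =ᵐ[μ.prod m] K ∘ Prod.map φ id := by
  have hCm : ∀ E ∈ C, MeasurableSet E := fun E hE => by
    have := MeasurableSpace.measurableSet_generateFrom hE
    rw [← hC] at this
    exact this
  have hΦ : Measurable (Prod.map φ (id : Y → Y)) := hφ.prodMap measurable_id
  have : IsProbabilityMeasure (μ.map φ) := Measure.isProbabilityMeasure_map hφ.aemeasurable
  have hmap : (μ.prod m).map (Prod.map φ id) = (μ.map φ).prod m := by
    rw [← Measure.map_prod_map _ _ hφ measurable_id, Measure.map_id]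
  have hfm : IsFiniteMeasure ((μ.prod m).withDensity H) := isFiniteMeasure_withDensity hfin
  -- The density `K` of the pushed-forward measure `κ` is the conditional expectation of `H` given
  -- `(φ x, y)`. It remains to show that nothing was lost.
  set κ := ((μ.prod m).withDensity H).map (Prod.map φ id) with hκ
  have hac : κ ≪ (μ.map φ).prod m := by
    rw [← hmap]
    exact (withDensity_absolutelyContinuous _ _).map hΦ
  set K := κ.rnDeriv ((μ.map φ).prod m) with hK
  have hKm : Measurable K := Measure.measurable_rnDeriv _ _
  have hκK : ((μ.map φ).prod m).withDensity K = κ := Measure.withDensity_rnDeriv_eq _ _ hac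
  refine ⟨K, hKm, ?_⟩
  have hsec : ∀ E ∈ C, ∀ A, MeasurableSet A →
      ∫⁻ p in A ×ˢ E, H p ∂(μ.prod m) = ∫⁻ p in A ×ˢ E, K (Prod.map φ id p) ∂(μ.prod m) := by
    intro E hE A hA
    obtain ⟨g, hg, hge⟩ := h E hE
    have hEm := hCm E hE
    have hKE : Measurable fun b => ∫⁻ y in E, K (b, y) ∂m := hKm.lintegral_prod_right'
    -- Integrated over any `B`, both sides give `κ (B ×ˢ E)`. Thus for a.e. `x` the sections of `H`
    -- and of `K ∘ Prod.map φ id` have the same integral over `E`.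
    have hgK : g =ᵐ[μ.map φ] fun b => ∫⁻ y in E, K (b, y) ∂m := by
      refine ae_eq_of_forall_setLIntegral_eq_of_sigmaFinite hg hKE fun B hB _ => ?_
      rw [setLIntegral_map hB hg hφ]
      have e1 : ∫⁻ x in φ ⁻¹' B, g (φ x) ∂μ =
          ∫⁻ p in (φ ⁻¹' B) ×ˢ E, H p ∂(μ.prod m) := by
        rw [← Measure.prod_restrict, lintegral_prod _ hH.aemeasurable]
        exact lintegral_congr_ae (ae_restrict_of_ae hge.symm)
      have e2 : ∫⁻ b in B, ∫⁻ y in E, K (b, y) ∂m ∂(μ.map φ) = κ (B ×ˢ E) := by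
        rw [← hκK, withDensity_apply _ (hB.prod hEm), ← Measure.prod_restrict,
          lintegral_prod _ hKm.aemeasurable]
      rw [e1, e2, hκ, Measure.map_apply hΦ (hB.prod hEm),
        withDensity_apply _ (hΦ (hB.prod hEm))]
      rfl
    rw [← Measure.prod_restrict, lintegral_prod _ hH.aemeasurable]
    refine Eq.trans ?_ (lintegral_prod _ (hKm.comp hΦ).aemeasurable).symm
    refine lintegral_congr_ae (ae_restrict_of_ae ?_)
    filter_upwards [hge, ae_of_ae_map hφ.aemeasurable hgK] with x h1 h2
    exact h1.trans h2
  rw [← withDensity_eq_iff hH.aemeasurable (hKm.comp hΦ).aemeasurable hfin]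
  refine ext_of_generate_finite _ (generateFrom_eq_prod (C := {A : Set X | MeasurableSet A})
    MeasurableSpace.generateFrom_measurableSet hC.symm isCountablySpanning_measurableSet
    ⟨fun _ => Set.univ, fun _ => huniv, Set.iUnion_const _⟩).symm
    (MeasurableSpace.isPiSystem_measurableSet.prod hpi) ?_ ?_
  · rintro _ ⟨A, hA, E, hE, rfl⟩
    have hm : MeasurableSet (A ×ˢ E) := MeasurableSet.prod hA (hCm E hE)
    rw [withDensity_apply _ hm, withDensity_apply _ hm]
    exact hsec E hE A hA
  · rw [withDensity_apply _ .univ, withDensity_apply _ .univ, ← Set.univ_prod_univ]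
    exact hsec _ huniv _ .univ

/-- A symmetric function on `X × X` is a.e. a function of `(φ x, φ y)` if its integrals over the
sets of a generating π-system of `X` are a.e. functions of `φ x`. -/
theorem exists_ae_eq_comp_prodMap_symm {μ : Measure X} [IsProbabilityMeasure μ] {φ : X → X'}
    (hφ : Measurable φ) {H : X × X → ℝ≥0∞} (hH : Measurable H)
    (hsymm : ∀ x y, H (x, y) = H (y, x)) (hfin : ∫⁻ p, H p ∂(μ.prod μ) ≠ ∞) {C : Set (Set X)}
    (hC : (inferInstance : MeasurableSpace X) = MeasurableSpace.generateFrom C)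
    (hpi : IsPiSystem C) (huniv : Set.univ ∈ C)
    (h : ∀ E ∈ C, ∃ g : X' → ℝ≥0∞, Measurable g ∧
      (fun x => ∫⁻ y in E, H (x, y) ∂μ) =ᵐ[μ] g ∘ φ) :
    ∃ K : X' × X' → ℝ≥0∞, Measurable K ∧ H =ᵐ[μ.prod μ] K ∘ Prod.map φ φ := by
  obtain ⟨K, hK, hHK⟩ := exists_ae_eq_comp_prodMap hφ hH hfin hC hpi huniv h
  have : IsProbabilityMeasure (μ.map φ) := Measure.isProbabilityMeasure_map hφ.aemeasurable
  have hΦ : MeasurePreserving (Prod.map id φ) (μ.prod μ) (μ.prod (μ.map φ)) :=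
    (MeasurePreserving.id μ).prod (hφ.measurePreserving μ)
  have hswap : ∀ᵐ p ∂(μ.prod μ), H p = K (φ p.2, p.1) := by
    have := Measure.measurePreserving_swap (μ := μ) (ν := μ) |>.quasiMeasurePreserving.ae hHK
    filter_upwards [this] with p hp
    rw [show H p = H p.swap from hsymm p.1 p.2, hp]
    rfl
  have hKs : Measurable fun q : X × X' => K q.swap := hK.comp measurable_swap
  -- By symmetry `H (x, y)` is a.e. `K (φ y, x)`, so the first variable can be factored too. The
  -- integral of `K (φ y, x)` over `φ y ∈ E` is that of `H (x, y)`, hence of `K (φ x, y)`, which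
  -- depends on `φ x` only.
  obtain ⟨J, hJ, hKJ⟩ := exists_ae_eq_comp_prodMap (m := μ.map φ) hφ hKs (by
      rw [← hΦ.lintegral_comp hKs]
      convert hfin using 1
      exact lintegral_congr_ae (hswap.mono fun p hp => hp.symm))
    MeasurableSpace.generateFrom_measurableSet.symm MeasurableSpace.isPiSystem_measurableSet
    MeasurableSet.univ (fun E hE => by
      have hE : MeasurableSet E := hE
      refine ⟨fun b => ∫⁻ y in φ ⁻¹' E, K (b, y) ∂μ, hK.lintegral_prod_right', ?_⟩
      filter_upwards [Measure.ae_ae_of_ae_prod hHK, Measure.ae_ae_of_ae_prod hswap] with x h1 h2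
      rw [setLIntegral_map hE (by fun_prop) hφ]
      refine lintegral_congr_ae (ae_restrict_of_ae ?_)
      filter_upwards [h1, h2] with y h3 h4
      exact h4.symm.trans h3)
  refine ⟨J, hJ, ?_⟩
  filter_upwards [hswap, hΦ.quasiMeasurePreserving.ae hKJ] with p h1 h2
  rw [h1]
  exact h2

end Factor

/-! ### The common quotient of two coupled kernels -/

lemma ae_map_iff_prodMap {Ω Ω' : Type*} [MeasurableSpace Ω] [MeasurableSpace Ω'] {μ : Measure Ω}
    {μ' : Measure Ω'} [SFinite μ] [SFinite μ'] {φ : Ω → Ω'}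
    (hφ : MeasurePreserving φ μ μ') {F G : Ω' × Ω' → ℝ} (hF : Measurable F) (hG : Measurable G) :
    F =ᵐ[μ'.prod μ'] G ↔ pullback F φ =ᵐ[μ.prod μ] pullback G φ := by
  have h := hφ.prod hφ
  rw [← h.map_eq]
  exact ae_map_iff h.measurable.aemeasurable (measurableSet_eq_fun hF hG)

lemma measurable_pullback {Ω Ω' : Type*} [MeasurableSpace Ω] [MeasurableSpace Ω'] {φ : Ω → Ω'}
    (hφ : Measurable φ) {F : Ω' × Ω' → ℝ} (hF : Measurable F) : Measurable (pullback F φ) :=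
  hF.comp (hφ.prodMap hφ)

lemma IsKernel.of_measurable_pullback {Ω Ω' : Type*} [MeasurableSpace Ω] [MeasurableSpace Ω']
    {μ : Measure Ω} {μ' : Measure Ω'} [IsProbabilityMeasure μ] [IsProbabilityMeasure μ']
    {V : Ω × Ω → ℝ} {φ : Ω → Ω'} (hφ : MeasurePreserving φ μ μ') (hV : IsKernel μ V)
    {W : Ω' × Ω' → ℝ} (hW : Measurable W) (hW0 : ∀ p, 0 ≤ W p)
    (hsymm : ∀ x y, W (x, y) = W (y, x)) (h : V =ᵐ[μ.prod μ] pullback W φ) : IsKernel μ' W := by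
  refine ⟨hW, hsymm, hW0, ?_⟩
  rw [← (hφ.prod hφ).map_eq, integrable_map_measure hW.aestronglyMeasurable
    (hφ.prod hφ).measurable.aemeasurable]
  exact hV.integrable.congr h

/-- Two kernels that agree a.e. under a coupling are a.e. pull-backs of a common kernel. -/
theorem arePullbacksOfKernelOn_of_coupling {X Y : Type*} [TopologicalSpace X] [T2Space X]
    [CompactSpace X] [TotallyDisconnectedSpace X] [SecondCountableTopology X] [MeasurableSpace X]
    [BorelSpace X] [MeasurableSpace Y] {ν : Measure (X × Y)} [IsProbabilityMeasure ν]
    {V₁ : X × X → ℝ} {V₂ : Y × Y → ℝ} (hV₁ : IsKernel ν.fst V₁) (hV₂ : IsKernel ν.snd V₂)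
    (h : pullback V₁ Prod.fst =ᵐ[ν.prod ν] pullback V₂ Prod.snd) :
    ∃ μ : Measure (ULift.{w} (TopologicalSpace.Clopens X) → ENNReal), IsProbabilityMeasure μ ∧
      ArePullbacksOfKernelOn ν.fst ν.snd V₁ V₂ μ := by
  have m₁ := hV₁.measurable
  have m₂ := hV₂.measurable
  have k₁ : MeasurePreserving (Prod.fst : X × Y → X) ν ν.fst := ⟨measurable_fst, rfl⟩
  have k₂ : MeasurePreserving (Prod.snd : X × Y → Y) ν ν.snd := ⟨measurable_snd, rfl⟩
  let H : X × X → ENNReal := fun p => ENNReal.ofReal (V₁ p)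
  have hH : Measurable H := by fun_prop
  let φ₁ : X → ULift.{w} (TopologicalSpace.Clopens X) → ENNReal := fun x E =>
    ∫⁻ x' in (E.down : Set X), H (x, x') ∂ν.fst
  -- The test sets are still clopen sets of `X`, so the integral runs over the coupling `ν`; the
  -- value nevertheless depends on `y` only.
  let φ₂ : Y → ULift.{w} (TopologicalSpace.Clopens X) → ENNReal := fun y E =>
    ∫⁻ p in Prod.fst ⁻¹' (E.down : Set X), ENNReal.ofReal (V₂ (y, p.2)) ∂ν
  have hφ₁ : Measurable φ₁ := measurable_pi_lambda _ fun E => hH.lintegral_prod_right'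
  have hφ₂ : Measurable φ₂ := measurable_pi_lambda _ fun E =>
    Measurable.lintegral_prod_right' (f := fun q : Y × (X × Y) => ENNReal.ofReal (V₂ (q.1, q.2.2)))
      (by fun_prop)
  have hφ : φ₁ ∘ Prod.fst =ᵐ[ν] φ₂ ∘ Prod.snd := by
    filter_upwards [Measure.ae_ae_of_ae_prod h] with z hz
    ext E
    have hE : MeasurableSet (E.down : Set X) := E.down.isClopen.isOpen.measurableSet
    change ∫⁻ x' in (E.down : Set X), H (z.1, x') ∂ν.fst = _
    rw [Measure.fst, setLIntegral_map hE (by fun_prop) measurable_fst]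
    refine lintegral_congr_ae (ae_restrict_of_ae ?_)
    filter_upwards [hz] with p hp
    exact congrArg ENNReal.ofReal hp
  let μ := ν.fst.map φ₁
  have p₁ : MeasurePreserving φ₁ ν.fst μ := hφ₁.measurePreserving _
  have p₂ : MeasurePreserving φ₂ ν.snd μ := by
    refine ⟨hφ₂, ?_⟩
    rw [Measure.snd, Measure.map_map hφ₂ measurable_snd, ← Measure.map_congr hφ,
      ← Measure.map_map hφ₁ measurable_fst]
    rfl
  have hμ : IsProbabilityMeasure μ := Measure.isProbabilityMeasure_map hφ₁.aemeasurable
  have hgen : (inferInstance : MeasurableSpace X) =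
      MeasurableSpace.generateFrom {S : Set X | IsClopen S} := by
    rw [BorelSpace.measurable_eq (α := X)]
    exact loc_compact_Haus_tot_disc_of_zero_dim.borel_eq_generateFrom
  obtain ⟨K, hK, hHK⟩ := exists_ae_eq_comp_prodMap_symm hφ₁ hH
    (fun x y => congrArg ENNReal.ofReal (hV₁.symmetric x y)) hV₁.integrable.lintegral_lt_top.ne
    hgen (fun S hS T hT _ => IsClopen.inter hS hT) isClopen_univ
    (fun E hE => ⟨fun c => c ⟨⟨E, hE⟩⟩, measurable_pi_apply _, .rfl⟩)
  -- `K` need be neither finite nor symmetric off a null set of the pull-back, whereas a kernel must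
  -- be both everywhere.
  let W : (ULift.{w} (TopologicalSpace.Clopens X) → ENNReal) × (ULift.{w} (TopologicalSpace.Clopens X) → ENNReal) → ℝ :=
    fun q => ((K q).toReal + (K q.swap).toReal) / 2
  have hW : Measurable W := by fun_prop
  have hV₁W : V₁ =ᵐ[ν.fst.prod ν.fst] pullback W φ₁ := by
    have hswap := (Measure.measurePreserving_swap (μ := ν.fst)
      (ν := ν.fst)).quasiMeasurePreserving.ae hHK
    filter_upwards [hHK, hswap] with p h1 h2
    have e1 : (K (φ₁ p.1, φ₁ p.2)).toReal = V₁ p := by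
      rw [← ENNReal.toReal_ofReal (hV₁.nonneg p)]
      exact congrArg ENNReal.toReal h1.symm
    have e2 : (K (φ₁ p.2, φ₁ p.1)).toReal = V₁ p := by
      rw [show V₁ p = V₁ p.swap from hV₁.symmetric p.1 p.2,
        ← ENNReal.toReal_ofReal (hV₁.nonneg p.swap)]
      exact congrArg ENNReal.toReal h2.symm
    simp [pullback, W, e1, e2]
  refine ⟨μ, hμ, W, φ₁, φ₂, ?_, p₁, p₂, hV₁W, ?_⟩
  · exact hV₁.of_measurable_pullback p₁ hW (fun p => by positivity)
      (fun x y => by simp [W, add_comm]) hV₁W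
  · rw [ae_map_iff_prodMap k₂ m₂ (measurable_pullback hφ₂ hW)]
    rw [ae_map_iff_prodMap k₁ m₁ (measurable_pullback hφ₁ hW)] at hV₁W
    have q₁ := (Measure.quasiMeasurePreserving_fst (μ := ν) (ν := ν)).ae hφ
    have q₂ := (Measure.quasiMeasurePreserving_snd (μ := ν) (ν := ν)).ae hφ
    filter_upwards [h, hV₁W, q₁, q₂] with p h1 h2 h3 h4
    rw [← h1, h2]
    simp only [pullback, Function.comp_apply] at h3 h4 ⊢
    rw [h3, h4]

lemma ArePullbacksOfKernelOn.comp {Ω₁ Ω₂ X Y Ω : Type*}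
    [MeasurableSpace Ω₁] [MeasurableSpace Ω₂] [MeasurableSpace X] [MeasurableSpace Y]
    [MeasurableSpace Ω] {μ₁ : Measure Ω₁} {μ₂ : Measure Ω₂} [IsProbabilityMeasure μ₁]
    [IsProbabilityMeasure μ₂] {m₁ : Measure X} {m₂ : Measure Y} [IsProbabilityMeasure m₁]
    [IsProbabilityMeasure m₂] {μ : Measure Ω} {V₁ : X × X → ℝ}
    {V₂ : Y × Y → ℝ} {ψ₁ : Ω₁ → X} {ψ₂ : Ω₂ → Y} (hψ₁ : MeasurePreserving ψ₁ μ₁ m₁)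
    (hψ₂ : MeasurePreserving ψ₂ μ₂ m₂) (h : ArePullbacksOfKernelOn m₁ m₂ V₁ V₂ μ) :
    ArePullbacksOfKernelOn μ₁ μ₂ (pullback V₁ ψ₁) (pullback V₂ ψ₂) μ := by
  obtain ⟨W, φ₁, φ₂, hW, h₁, h₂, e₁, e₂⟩ := h
  exact ⟨W, φ₁ ∘ ψ₁, φ₂ ∘ ψ₂, hW, h₁.comp hψ₁, h₂.comp hψ₂,
    (hψ₁.prod hψ₁).quasiMeasurePreserving.ae e₁, (hψ₂.prod hψ₂).quasiMeasurePreserving.ae e₂⟩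

/-- The common kernel may be pulled back along a measure-preserving map through which both given
maps factor a.e. -/
lemma ArePullbacksOfKernelOn.of_factor {Ω₁ Ω₂ Ω Ω' : Type*}
    [MeasurableSpace Ω₁] [MeasurableSpace Ω₂] [MeasurableSpace Ω] [MeasurableSpace Ω']
    {μ₁ : Measure Ω₁} {μ₂ : Measure Ω₂} [IsProbabilityMeasure μ₁]
    [IsProbabilityMeasure μ₂] {μ : Measure Ω} {μ' : Measure Ω'} [IsProbabilityMeasure μ]
    [IsProbabilityMeasure μ'] {W : Ω × Ω → ℝ} {W₁ : Ω₁ × Ω₁ → ℝ} {W₂ : Ω₂ × Ω₂ → ℝ}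
    {φ₁ : Ω₁ → Ω} {φ₂ : Ω₂ → Ω} {χ₁ : Ω₁ → Ω'} {χ₂ : Ω₂ → Ω'} {Q : Ω' → Ω}
    (hW : IsKernel μ W) (e₁ : W₁ =ᵐ[μ₁.prod μ₁] pullback W φ₁)
    (e₂ : W₂ =ᵐ[μ₂.prod μ₂] pullback W φ₂) (hQ : MeasurePreserving Q μ' μ)
    (h₁ : MeasurePreserving χ₁ μ₁ μ') (h₂ : MeasurePreserving χ₂ μ₂ μ')
    (q₁ : φ₁ =ᵐ[μ₁] Q ∘ χ₁) (q₂ : φ₂ =ᵐ[μ₂] Q ∘ χ₂) :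
    ArePullbacksOfKernelOn μ₁ μ₂ W₁ W₂ μ' := by
  refine ⟨pullback W Q, χ₁, χ₂, ⟨measurable_pullback hQ.measurable hW.measurable,
    fun x y => hW.symmetric _ _, fun p => hW.nonneg _, hW.integrable_pullback hQ⟩, h₁, h₂, ?_, ?_⟩
  · filter_upwards [e₁, Measure.quasiMeasurePreserving_fst.ae q₁,
      Measure.quasiMeasurePreserving_snd.ae q₁] with p a b c
    simp only [a, pullback, b, c, Function.comp_apply]
  · filter_upwards [e₂, Measure.quasiMeasurePreserving_fst.ae q₂,
      Measure.quasiMeasurePreserving_snd.ae q₂] with p a b c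
    simp only [a, pullback, b, c, Function.comp_apply]

/-- If the cut distance is zero, the two kernels are a.e. pull-backs of a kernel on a standard
Borel space. -/
theorem exists_standardBorel_of_cutDist_eq_zero {Ω₁ : Type u} {Ω₂ : Type v} [MeasurableSpace Ω₁]
    [MeasurableSpace Ω₂] {μ₁ : Measure Ω₁} {μ₂ : Measure Ω₂} [IsProbabilityMeasure μ₁]
    [IsProbabilityMeasure μ₂] {W₁ : Ω₁ × Ω₁ → ℝ} {W₂ : Ω₂ × Ω₂ → ℝ}
    (hW₁ : IsKernel μ₁ W₁) (hW₂ : IsKernel μ₂ W₂) {ver : CutNormVersion}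
    (h : cutDist.{u, v, t} ver μ₁ μ₂ W₁ W₂ = 0) :
    ∃ (Ω : Type w) (_ : MeasurableSpace Ω) (μ : Measure Ω), IsProbabilityMeasure μ ∧
      StandardBorelSpace Ω ∧ ArePullbacksOfKernelOn μ₁ μ₂ W₁ W₂ μ := by
  obtain ⟨ψ₁, V₁, hψ₁, hV₁, rfl⟩ := hW₁.exists_cantor
  obtain ⟨ψ₂, V₂, hψ₂, hV₂, rfl⟩ := hW₂.exists_cantor
  have : IsProbabilityMeasure (μ₁.map ψ₁) := Measure.isProbabilityMeasure_map hψ₁.aemeasurable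
  have : IsProbabilityMeasure (μ₂.map ψ₂) := Measure.isProbabilityMeasure_map hψ₂.aemeasurable
  obtain ⟨ν, _, h₁, h₂, hν⟩ := exists_coupling_ae_eq hV₁ hV₂ fun ε hε =>
    exists_coupling_of_cutDist_eq_zero hψ₁ hψ₂ hV₁ hV₂ h hε
  rw [← h₁] at hV₁
  rw [← h₂] at hV₂
  obtain ⟨μ, hμ, hW⟩ := arePullbacksOfKernelOn_of_coupling.{w} hV₁ hV₂ hν
  -- Countability makes the space of families of section integrals a countable product of standard
  -- Borel spaces.
  have : Countable (TopologicalSpace.Clopens (ℕ → Bool)) :=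
    TopologicalSpace.Clopens.countable_iff_secondCountable.2 inferInstance
  exact ⟨_, _, μ, hμ, inferInstance, hW.comp ⟨hψ₁, h₁.symm⟩ ⟨hψ₂, h₂.symm⟩⟩

/-! ### Pull-backs of a common kernel have cut distance zero -/

section Converse

open Filter Topology

/-- Integrable functions on a square are approximated in `L¹` by functions of finitely many
classes. -/
lemma exists_pullback_nat_approx {X : Type*} [TopologicalSpace X]
    [TopologicalSpace.MetrizableSpace X] [SecondCountableTopology X] [MeasurableSpace X]
    [BorelSpace X] {m : Measure X} [IsProbabilityMeasure m] {V : X × X → ℝ}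
    (hV : Integrable V (m.prod m)) {ε : ℝ} (hε : 0 < ε) :
    ∃ (q : X → ℕ) (A : ℕ × ℕ → ℝ), Measurable q ∧ Integrable (pullback A q) (m.prod m) ∧
      ∫ p, |V p - pullback A q p| ∂(m.prod m) ≤ ε := by
  let _ : MetricSpace X := TopologicalSpace.metrizableSpaceMetric X
  have : Nonempty X := m.nonempty_of_neZero
  obtain ⟨U, hU, iU⟩ := hV.exists_boundedContinuous_integral_sub_le
    (show 0 < ε / 2 by positivity)
  let e : ℕ → X := TopologicalSpace.denseSeq X
  -- The class of a point is the index of its nearest point in an initial segment of a dense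
  -- sequence.
  let q : ℕ → X → ℕ := fun N => SimpleFunc.nearestPtInd e N
  have hq : ∀ N, Measurable (q N) := fun N => SimpleFunc.measurable _
  let A : ℕ × ℕ → ℝ := fun i => U (e i.1, e i.2)
  have hA : ∀ N, Measurable (pullback A (q N)) := fun N =>
    measurable_pullback (hq N) (measurable_of_countable A)
  have iA : ∀ N, Integrable (pullback A (q N)) (m.prod m) := fun N =>
    (integrable_const ‖U‖).mono' (hA N).aestronglyMeasurable
      (.of_forall fun p => U.norm_coe_le_norm _)
  have hx : ∀ x : X, Tendsto (fun N => e (q N x)) atTop (𝓝 x) := fun x =>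
    SimpleFunc.tendsto_nearestPt (TopologicalSpace.denseRange_denseSeq X x)
  have hlim : Tendsto (fun N => ∫ p, |U p - pullback A (q N) p| ∂(m.prod m)) atTop (𝓝 0) := by
    have h := tendsto_integral_of_dominated_convergence
      (F := fun N p => |U p - pullback A (q N) p|) (f := fun _ => 0) (μ := m.prod m)
      (fun _ => ‖U‖ + ‖U‖) (fun N => (iU.sub (iA N)).abs.aestronglyMeasurable)
      (integrable_const _) (fun N => .of_forall fun p => ?_) (.of_forall fun p => ?_)
    · simpa using h
    · rw [norm_abs_eq_norm]
      exact (norm_sub_le _ _).trans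
        (add_le_add (U.norm_coe_le_norm _) (U.norm_coe_le_norm _))
    · have h1 : Tendsto (fun N => pullback A (q N) p) atTop (𝓝 (U p)) :=
        (U.continuous.tendsto p).comp ((hx p.1).prodMk_nhds (hx p.2))
      simpa using (h1.const_sub (U p)).abs
  obtain ⟨N, hN⟩ := (hlim.eventually (gt_mem_nhds (show 0 < ε / 2 by positivity))).exists
  refine ⟨q N, A, hq N, iA N, ?_⟩
  calc ∫ p, |V p - pullback A (q N) p| ∂(m.prod m)
      ≤ ∫ p, (‖V p - U p‖ + |U p - pullback A (q N) p|) ∂(m.prod m) :=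
        integral_mono (hV.sub (iA N)).abs ((hV.sub iU).norm.add (iU.sub (iA N)).abs)
          fun p => abs_sub_le _ _ _
    _ = (∫ p, ‖V p - U p‖ ∂(m.prod m)) + ∫ p, |U p - pullback A (q N) p| ∂(m.prod m) :=
        integral_add (hV.sub iU).norm (iU.sub (iA N)).abs
    _ ≤ ε := by linarith

lemma IsKernel.exists_pullback_nat_approx {Ω : Type*} [MeasurableSpace Ω] {μ : Measure Ω}
    [IsProbabilityMeasure μ] {W : Ω × Ω → ℝ} (hW : IsKernel μ W) {ε : ℝ} (hε : 0 < ε) :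
    ∃ (q : Ω → ℕ) (A : ℕ × ℕ → ℝ), Measurable q ∧ Integrable (pullback A q) (μ.prod μ) ∧
      ∫ p, |W p - pullback A q p| ∂(μ.prod μ) ≤ ε := by
  obtain ⟨ψ, V, hψ, hV, rfl⟩ := hW.exists_cantor
  have : IsProbabilityMeasure (μ.map ψ) := Measure.isProbabilityMeasure_map hψ.aemeasurable
  obtain ⟨q, A, hq, iA, h⟩ := CutMetric.exists_pullback_nat_approx hV.integrable hε
  have hp := hψ.measurePreserving μ
  refine ⟨q ∘ ψ, A, hq.comp hψ, (hp.prod hp).integrable_comp_of_integrable iA, ?_⟩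
  exact (integral_prod_pullback hp (hV.integrable.sub iA).abs.aestronglyMeasurable).trans_le h

lemma sum_restrict_fiber {Ω : Type*} [MeasurableSpace Ω] (μ : Measure Ω) {q : Ω → ℕ}
    (hq : Measurable q) : Measure.sum (fun i => μ.restrict (q ⁻¹' {i})) = μ := by
  rw [← Measure.restrict_iUnion (fun i j hij => ?_)
    (fun i => hq (measurableSet_singleton i)), ← Set.preimage_iUnion, Set.iUnion_of_singleton,
    Set.preimage_univ, Measure.restrict_univ]
  exact Set.disjoint_left.2 fun x hx hy =>
    hij ((Set.mem_singleton_iff.1 hx).symm.trans (Set.mem_singleton_iff.1 hy))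

lemma inv_smul_smul_restrict {Ω : Type*} [MeasurableSpace Ω] (μ : Measure Ω) [IsFiniteMeasure μ]
    (S : Set Ω) : (μ S)⁻¹ • μ S • μ.restrict S = μ.restrict S := by
  by_cases h : μ S = 0
  · simp [Measure.restrict_eq_zero.2 h]
  · rw [smul_smul, ENNReal.inv_mul_cancel h (measure_ne_top μ S), one_smul]

/-- Two measures with the same image under discrete maps have a coupling under which these maps
agree. -/
lemma exists_coupling_of_map_eq {Ω₁ Ω₂ : Type*} [MeasurableSpace Ω₁] [MeasurableSpace Ω₂]
    {μ₁ : Measure Ω₁} {μ₂ : Measure Ω₂} [IsProbabilityMeasure μ₁] [IsProbabilityMeasure μ₂]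
    {q₁ : Ω₁ → ℕ} {q₂ : Ω₂ → ℕ} (h₁ : Measurable q₁) (h₂ : Measurable q₂)
    (h : μ₁.map q₁ = μ₂.map q₂) :
    ∃ ν : Measure (Ω₁ × Ω₂), IsProbabilityMeasure ν ∧ ν.fst = μ₁ ∧ ν.snd = μ₂ ∧
      ∀ᵐ z ∂ν, q₁ z.1 = q₂ z.2 := by
  have s₁ : ∀ i, MeasurableSet (q₁ ⁻¹' {i}) := fun i => h₁ (measurableSet_singleton i)
  have s₂ : ∀ i, MeasurableSet (q₂ ⁻¹' {i}) := fun i => h₂ (measurableSet_singleton i)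
  have hm : ∀ i, μ₁ (q₁ ⁻¹' {i}) = μ₂ (q₂ ⁻¹' {i}) := fun i => by
    rw [← Measure.map_apply h₁ (measurableSet_singleton i), h,
      Measure.map_apply h₂ (measurableSet_singleton i)]
  -- Independent coupling inside each class, normalised by the common mass of the class. On a null
  -- class the product measure is zero, so the infinite factor is harmless.
  let ν : Measure (Ω₁ × Ω₂) := Measure.sum fun i =>
    (μ₁ (q₁ ⁻¹' {i}))⁻¹ • (μ₁.restrict (q₁ ⁻¹' {i})).prod (μ₂.restrict (q₂ ⁻¹' {i}))
  have hfst : ν.fst = μ₁ := by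
    rw [Measure.fst_sum]
    conv_rhs => rw [← sum_restrict_fiber μ₁ h₁]
    congr 1 with i : 1
    rw [Measure.fst, Measure.map_smul, Measure.map_fst_prod, Measure.restrict_apply_univ, ← hm i]
    exact inv_smul_smul_restrict _ _
  have hsnd : ν.snd = μ₂ := by
    rw [Measure.snd_sum]
    conv_rhs => rw [← sum_restrict_fiber μ₂ h₂]
    congr 1 with i : 1
    rw [Measure.snd, Measure.map_smul, Measure.map_snd_prod, Measure.restrict_apply_univ, hm i]
    exact inv_smul_smul_restrict _ _
  refine ⟨ν, ⟨?_⟩, hfst, hsnd, ?_⟩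
  · rw [← Measure.fst_univ, hfst, measure_univ]
  · refine (Measure.ae_sum_iff' (measurableSet_eq_fun (h₁.comp measurable_fst)
      (h₂.comp measurable_snd))).2 fun i => Measure.ae_smul_measure ?_ _
    rw [Measure.prod_restrict]
    filter_upwards [ae_restrict_mem ((s₁ i).prod (s₂ i))] with z hz
    exact (Set.mem_singleton_iff.1 hz.1).trans (Set.mem_singleton_iff.1 hz.2).symm

/-- Either cut norm is dominated by the `L¹` norm, so it suffices to make the latter small on a
coupling. -/
lemma cutDist_le_of_coupling {Ω₁ : Type u} {Ω₂ : Type v} [MeasurableSpace Ω₁]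
    [MeasurableSpace Ω₂] {μ₁ : Measure Ω₁} {μ₂ : Measure Ω₂} [IsProbabilityMeasure μ₁]
    [IsProbabilityMeasure μ₂] {W₁ : Ω₁ × Ω₁ → ℝ} {W₂ : Ω₂ × Ω₂ → ℝ} (hW₁ : IsKernel μ₁ W₁)
    (hW₂ : IsKernel μ₂ W₂) (ver : CutNormVersion) {ν : Measure (Ω₁ × Ω₂)}
    [IsProbabilityMeasure ν] (h₁ : ν.fst = μ₁) (h₂ : ν.snd = μ₂) :
    cutDist.{u, v, t} ver μ₁ μ₂ W₁ W₂ ≤ ∫ p, |couplingDiff W₁ W₂ p| ∂(ν.prod ν) := by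
  let e : ULift.{max u v t} (Ω₁ × Ω₂) ≃ᵐ Ω₁ × Ω₂ := MeasurableEquiv.ulift
  have he : MeasurePreserving e (ν.map e.symm) ν := measurePreserving_ulift ν
  have : IsProbabilityMeasure (ν.map e.symm) :=
    Measure.isProbabilityMeasure_map e.symm.measurable.aemeasurable
  have k₁ : MeasurePreserving (Prod.fst : Ω₁ × Ω₂ → Ω₁) ν μ₁ := ⟨measurable_fst, h₁⟩
  have k₂ : MeasurePreserving (Prod.snd : Ω₁ × Ω₂ → Ω₂) ν μ₂ := ⟨measurable_snd, h₂⟩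
  have iW : Integrable (couplingDiff W₁ W₂) (ν.prod ν) :=
    (hW₁.integrable_pullback k₁).sub (hW₂.integrable_pullback k₂)
  have hle : cutNorm ver (ν.map e.symm) (pullback W₁ (Prod.fst ∘ e) - pullback W₂ (Prod.snd ∘ e)) ≤
      ∫ p, |couplingDiff W₁ W₂ p| ∂(ν.prod ν) := by
    refine (cutNorm_le_integral_abs ?_ ver).trans_eq ?_
    · exact (he.prod he).integrable_comp_of_integrable iW
    · exact integral_prod_pullback he iW.abs.aestronglyMeasurable
  unfold cutDist
  refine (csInf_le ⟨0, ?_⟩ ?_).trans hle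
  rotate_left
  · exact ⟨_, inferInstance, ν.map e.symm, Prod.fst ∘ e, Prod.snd ∘ e, this, k₁.comp he,
      k₂.comp he, rfl⟩
  rintro _ ⟨_, _, _, _, _, _, _, _, rfl⟩
  exact cutNorm_nonneg ver

/-- Kernels that are a.e. pull-backs of a common kernel have cut distance zero. -/
theorem ArePullbacksOfKernelOn.cutDist_eq_zero {Ω₁ : Type u} {Ω₂ : Type v} {Ω : Type w}
    [MeasurableSpace Ω₁] [MeasurableSpace Ω₂] [MeasurableSpace Ω] {μ₁ : Measure Ω₁}
    {μ₂ : Measure Ω₂} [IsProbabilityMeasure μ₁] [IsProbabilityMeasure μ₂] {μ : Measure Ω}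
    [IsProbabilityMeasure μ] {W₁ : Ω₁ × Ω₁ → ℝ} {W₂ : Ω₂ × Ω₂ → ℝ} (hW₁ : IsKernel μ₁ W₁)
    (hW₂ : IsKernel μ₂ W₂) (ver : CutNormVersion) (h : ArePullbacksOfKernelOn μ₁ μ₂ W₁ W₂ μ) :
    cutDist.{u, v, t} ver μ₁ μ₂ W₁ W₂ = 0 := by
  obtain ⟨W, φ₁, φ₂, hW, h₁, h₂, e₁, e₂⟩ := h
  refine le_antisymm (le_of_forall_pos_le_add fun ε hε => ?_) (Real.sInf_nonneg ?_)
  · obtain ⟨q, A, hq, iA, hA⟩ := hW.exists_pullback_nat_approx (show 0 < ε / 2 by positivity)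
    obtain ⟨ν, _, hν₁, hν₂, hν⟩ := exists_coupling_of_map_eq (μ₁ := μ₁) (μ₂ := μ₂)
      (hq.comp h₁.measurable) (hq.comp h₂.measurable) (by
        rw [← Measure.map_map hq h₁.measurable, h₁.map_eq, ← h₂.map_eq,
          Measure.map_map hq h₂.measurable])
    refine (cutDist_le_of_coupling hW₁ hW₂ ver hν₁ hν₂).trans ?_
    have k₁ : MeasurePreserving (Prod.fst : Ω₁ × Ω₂ → Ω₁) ν μ₁ := ⟨measurable_fst, hν₁⟩
    have k₂ : MeasurePreserving (Prod.snd : Ω₁ × Ω₂ → Ω₂) ν μ₂ := ⟨measurable_snd, hν₂⟩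
    have p₁ := h₁.comp k₁
    have p₂ := h₂.comp k₂
    let D : Ω × Ω → ℝ := fun p => |W p - pullback A q p|
    have iD : Integrable D (μ.prod μ) := (hW.integrable.sub iA).abs
    have i₁ : Integrable (pullback D (φ₁ ∘ Prod.fst)) (ν.prod ν) :=
      (p₁.prod p₁).integrable_comp_of_integrable iD
    have i₂ : Integrable (pullback D (φ₂ ∘ Prod.snd)) (ν.prod ν) :=
      (p₂.prod p₂).integrable_comp_of_integrable iD
    -- Under `ν` the two points lie in the same class, so the step function takes the same value on
    -- both sides and can be inserted in the triangle inequality.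
    have hle : ∀ᵐ p ∂(ν.prod ν), |couplingDiff W₁ W₂ p| ≤
        pullback D (φ₁ ∘ Prod.fst) p + pullback D (φ₂ ∘ Prod.snd) p := by
      filter_upwards [(k₁.prod k₁).quasiMeasurePreserving.ae e₁,
        (k₂.prod k₂).quasiMeasurePreserving.ae e₂, Measure.quasiMeasurePreserving_fst.ae hν,
        Measure.quasiMeasurePreserving_snd.ae hν] with p a b c d
      simp only [couplingDiff, Pi.sub_apply, pullback, Prod.map_apply', Function.comp_apply, D]
        at a b c d ⊢
      rw [a, b, c, d, abs_sub_comm (W (φ₂ p.1.2, φ₂ p.2.2))]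
      exact abs_sub_le _ _ _
    calc ∫ p, |couplingDiff W₁ W₂ p| ∂(ν.prod ν)
        ≤ ∫ p, (pullback D (φ₁ ∘ Prod.fst) p + pullback D (φ₂ ∘ Prod.snd) p) ∂(ν.prod ν) :=
          integral_mono_of_nonneg (.of_forall fun _ => abs_nonneg _) (i₁.add i₂) hle
      _ = ∫ p, D p ∂(μ.prod μ) + ∫ p, D p ∂(μ.prod μ) := by
          rw [integral_add i₁ i₂, integral_prod_pullback p₁ iD.aestronglyMeasurable,
            integral_prod_pullback p₂ iD.aestronglyMeasurable]
      _ ≤ 0 + ε := by linarith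
  · rintro _ ⟨_, _, _, _, _, _, _, _, rfl⟩
    exact cutNorm_nonneg ver

end Converse

/-! ### Diffuse maps on atomless spaces -/

section Atomless

open Filter Topology

variable {Ω : Type*} [MeasurableSpace Ω] {μ : Measure Ω}

/-- There is a map to the Cantor space whose self-collision probability is minimal. -/
lemma exists_minimal_collision (μ : Measure Ω) : ∃ χ : Ω → ℕ → Bool, Measurable χ ∧
    ∀ ψ : Ω → ℕ → Bool, Measurable ψ →
      (μ.prod μ) {p | χ p.1 = χ p.2} ≤ (μ.prod μ) {p | ψ p.1 = ψ p.2} := by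
  let s : Set ENNReal :=
    {r | ∃ ψ : Ω → ℕ → Bool, Measurable ψ ∧ r = (μ.prod μ) {p | ψ p.1 = ψ p.2}}
  have hs : s.Nonempty := ⟨_, fun _ _ => true, measurable_const, rfl⟩
  obtain ⟨r, -, hr, hrs⟩ := exists_seq_tendsto_sInf hs (OrderBot.bddBelow s)
  choose ψ hψ he using hrs
  -- A common refinement of a minimizing sequence collides only where every member does, so it
  -- attains the infimum.
  obtain ⟨χ, hχ, hπ⟩ := exists_common_refinement ψ hψ
  refine ⟨χ, hχ, fun ψ' hψ' => ?_⟩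
  have hle : ∀ n, (μ.prod μ) {p | χ p.1 = χ p.2} ≤ r n := fun n => by
    rw [he n]
    obtain ⟨π, -, hn⟩ := hπ n
    refine measure_mono fun p (hp : χ p.1 = χ p.2) => ?_
    simp [hn, hp]
  exact (ge_of_tendsto' hr hle).trans (sInf_le ⟨ψ', hψ', rfl⟩)

/-- An atomless probability space has a measurable map to the unit interval with null fibres. -/
theorem IsAtomless.exists_diffuse [IsProbabilityMeasure μ] (h : IsAtomless μ) :
    ∃ u : Ω → unitInterval, Measurable u ∧ ∀ c, μ (u ⁻¹' {c}) = 0 := by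
  classical
  obtain ⟨χ, hχ, hmin⟩ := exists_minimal_collision μ
  have hnull : ∀ c, μ (χ ⁻¹' {c}) = 0 := by
    intro c
    by_contra hc
    set A := χ ⁻¹' {c} with hA
    have hAm : MeasurableSet A := hχ (measurableSet_singleton c)
    have hnot := h A
    simp only [IsAtomSet, not_and, not_forall, not_or] at hnot
    obtain ⟨B, hBA, hB, hB0, hB1⟩ := hnot hAm (pos_iff_ne_zero.2 hc)
    have hd : μ (A \ B) ≠ 0 := fun h0 =>
      hB1 (measure_eq_measure_of_null_sdiff hBA h0)
    -- A fibre `A` of positive measure is not an atom, so it splits into `B` and `A \ B`, both of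
    -- positive measure. Prepending the bit of `B` to `χ` removes the collisions in `B ×ˢ (A \ B)`,
    -- against minimality.
    let ψ : Ω → ℕ → Bool := fun x n => n.casesOn (decide (x ∈ B)) (χ x)
    have hψ : Measurable ψ := by
      refine measurable_pi_lambda _ fun n => ?_
      cases n with
      | zero => exact measurable_to_bool (by simpa [ψ, Set.preimage] using hB)
      | succ n => exact (measurable_pi_apply n).comp hχ
    have hsub : {p : Ω × Ω | ψ p.1 = ψ p.2} ∪ B ×ˢ (A \ B) ⊆ {p | χ p.1 = χ p.2} := by
      rintro p (hp | ⟨h1, h2, -⟩)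
      · ext n
        exact congrFun hp (n + 1)
      · exact (Set.mem_singleton_iff.1 (hBA h1)).trans (Set.mem_singleton_iff.1 h2).symm
    have hdisj : Disjoint {p : Ω × Ω | ψ p.1 = ψ p.2} (B ×ˢ (A \ B)) := by
      refine Set.disjoint_left.2 ?_
      rintro p hp ⟨h1, -, h2⟩
      refine h2 ?_
      have := congrFun hp 0
      simpa [ψ, h1] using this
    have hle := measure_mono (μ := μ.prod μ) hsub
    rw [measure_union hdisj (hB.prod (hAm.diff hB)), Measure.prod_prod] at hle
    have hfin : (μ.prod μ) {p | ψ p.1 = ψ p.2} ≠ ⊤ := measure_ne_top _ _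
    have hlt := ENNReal.lt_add_right hfin (mul_ne_zero hB0 hd)
    exact absurd (hmin ψ hψ) (not_le.2 (hlt.trans_le hle))
  let e : (ℕ → Bool) → unitInterval := unitInterval.sigmoid ∘ embeddingReal (ℕ → Bool)
  have he : Measurable e :=
    unitInterval.continuous_sigmoid.measurable.comp (measurable_embeddingReal _)
  have hinj : Function.Injective e :=
    unitInterval.sigmoid_injective.comp (measurableEmbedding_embeddingReal _).injective
  refine ⟨e ∘ χ, he.comp hχ, fun c => ?_⟩
  rcases (e ⁻¹' {c}).eq_empty_or_nonempty with h0 | ⟨a, ha⟩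
  · rw [Set.preimage_comp, h0, Set.preimage_empty, measure_empty]
  · exact measure_mono_null (fun x hx => hinj (Eq.trans hx ha.symm)) (hnull a)

end Atomless

/-! ### Quantile functions and uniform lifts -/

section Quantile

open Filter Topology ProbabilityTheory

open scoped Classical in
/-- The quantile function of a probability measure on the real line. -/
def quantile (m : Measure ℝ) (s : unitInterval) : ℝ :=
  if s ∈ Set.Ioo (0 : unitInterval) 1 then sInf {a : ℝ | (s : ℝ) ≤ cdf m a} else 0

variable {m : Measure ℝ}

/-- Right continuity of the distribution function makes the infimum attained. The endpoints are
excluded: at `0` the set is unbounded below, and at `1` it may be empty. -/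
lemma quantile_le_iff {s : unitInterval} (hs : s ∈ Set.Ioo (0 : unitInterval) 1) (a : ℝ) :
    quantile m s ≤ a ↔ (s : ℝ) ≤ cdf m a := by
  have h0 : (0 : ℝ) < s := hs.1
  have h1 : (s : ℝ) < 1 := hs.2
  rw [quantile, if_pos hs]
  have hne : {a : ℝ | (s : ℝ) ≤ cdf m a}.Nonempty :=
    (((tendsto_cdf_atTop m).eventually (lt_mem_nhds h1)).mono fun _ h => h.le).exists
  have hbdd : BddBelow {a : ℝ | (s : ℝ) ≤ cdf m a} := by
    obtain ⟨b, hb⟩ := ((tendsto_cdf_atBot m).eventually (gt_mem_nhds h0)).exists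
    exact ⟨b, fun a ha => le_of_lt ((monotone_cdf m).reflect_lt (hb.trans_le ha))⟩
  refine ⟨fun h => ?_, fun h => csInf_le hbdd h⟩
  have hlt : ∀ c ∈ Set.Ioi a, (s : ℝ) ≤ cdf m c := fun c hc => by
    obtain ⟨b, hb, hbc⟩ := exists_lt_of_csInf_lt hne (h.trans_lt hc)
    exact le_trans hb (monotone_cdf m hbc.le)
  exact ge_of_tendsto (((cdf m).right_continuous a).mono Set.Ioi_subset_Ici_self)
    (eventually_mem_nhdsWithin.mono hlt)

lemma ae_mem_Ioo_unitInterval : ∀ᵐ s ∂(volume : Measure unitInterval),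
    s ∈ Set.Ioo (0 : unitInterval) 1 := by
  filter_upwards [Measure.ae_ne volume 0, Measure.ae_ne volume 1] with s h0 h1
  exact ⟨unitInterval.pos_iff_ne_zero.2 h0, unitInterval.lt_one_iff_ne_one.2 h1⟩

lemma measurable_quantile : Measurable (quantile m) := by
  classical
  refine measurable_of_Iic fun a => ?_
  have : quantile m ⁻¹' Set.Iic a =
      (Set.Ioo 0 1 ∩ {s : unitInterval | (s : ℝ) ≤ cdf m a}) ∪
        ((Set.Ioo 0 1)ᶜ ∩ {_s : unitInterval | (0 : ℝ) ≤ a}) := by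
    ext s
    by_cases hs : s ∈ Set.Ioo (0 : unitInterval) 1
    · simp only [Set.mem_preimage, Set.mem_Iic, quantile_le_iff hs]
      simp [hs]
    · simp only [Set.mem_preimage, Set.mem_Iic, quantile, if_neg hs]
      simp [hs]
  rw [this]
  exact (measurableSet_Ioo.inter (measurableSet_le measurable_subtype_coe measurable_const)).union
    (measurableSet_Ioo.compl.inter (.const _))

lemma measurePreserving_quantile [IsProbabilityMeasure m] :
    MeasurePreserving (quantile m) volume m := by
  refine ⟨measurable_quantile, ?_⟩
  have : IsProbabilityMeasure ((volume : Measure unitInterval).map (quantile m)) :=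
    Measure.isProbabilityMeasure_map measurable_quantile.aemeasurable
  refine Measure.ext_of_Iic _ _ fun a => ?_
  rw [Measure.map_apply measurable_quantile measurableSet_Iic, ← ofReal_cdf,
    ← unitInterval.volume_Iic ⟨cdf m a, cdf_nonneg m a, cdf_le_one m a⟩]
  refine measure_congr ?_
  filter_upwards [ae_mem_Ioo_unitInterval] with s hs
  exact propext (quantile_le_iff hs a)

/-- Without atoms the distribution function equals its left limit, and to the left of the quantile
its values lie below `s`. -/
lemma cdf_quantile [IsProbabilityMeasure m] (hm : ∀ a, m {a} = 0) {s : unitInterval}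
    (hs : s ∈ Set.Ioo (0 : unitInterval) 1) : cdf m (quantile m s) = s := by
  refine le_antisymm ?_ ((quantile_le_iff hs _).1 le_rfl)
  have hl : cdf m (quantile m s) ≤ Function.leftLim (cdf m) (quantile m s) := by
    have := (cdf m).measure_singleton (quantile m s)
    rw [measure_cdf, hm, eq_comm, ENNReal.ofReal_eq_zero] at this
    linarith
  refine hl.trans (le_of_tendsto ((monotone_cdf m).tendsto_leftLim _)
    (eventually_mem_nhdsWithin.mono fun a ha => ?_))
  exact (not_le.1 fun h => not_le.2 ha ((quantile_le_iff hs a).2 h)).le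

/-- The distribution function with values in the unit interval. -/
def unitCdf (m : Measure ℝ) (a : ℝ) : unitInterval := ⟨cdf m a, cdf_nonneg m a, cdf_le_one m a⟩

lemma measurable_unitCdf : Measurable (unitCdf m) :=
  (monotone_cdf m).measurable.subtype_mk

/-- `m` is the image of Lebesgue measure under `quantile m`, and `unitCdf m` undoes that map a.e. -/
lemma measurePreserving_unitCdf [IsProbabilityMeasure m] (hm : ∀ a, m {a} = 0) :
    MeasurePreserving (unitCdf m) m volume := by
  refine ⟨measurable_unitCdf, ?_⟩
  have h : (volume.map (quantile m)).map (unitCdf m) = m.map (unitCdf m) := by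
    rw [measurePreserving_quantile.map_eq]
  rw [← h, Measure.map_map measurable_unitCdf measurable_quantile]
  refine (Measure.map_congr ?_).trans Measure.map_id
  filter_upwards [ae_mem_Ioo_unitInterval] with s hs
  exact Subtype.ext (cdf_quantile hm hs)

/-- Equal laws give equal integrals of a bounded strictly increasing function such as `arctan`; with
the inequality this forces equality a.e., without any integrability of `f` and `g`. -/
lemma ae_eq_of_ae_le_of_map_eq {Ω : Type*} [MeasurableSpace Ω] {μ : Measure Ω}
    [IsFiniteMeasure μ] {f g : Ω → ℝ} (hf : Measurable f) (hg : Measurable g)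
    (hle : f ≤ᵐ[μ] g) (h : μ.map f = μ.map g) : f =ᵐ[μ] g := by
  have hat : Measurable Real.arctan := Real.measurable_arctan
  have hint : ∀ {k : Ω → ℝ}, Measurable k → Integrable (fun x => Real.arctan (k x)) μ :=
    fun {k} hk => (integrable_const (Real.pi / 2)).mono' (hat.comp hk).aestronglyMeasurable
      (.of_forall fun x => abs_le.2
        ⟨(Real.neg_pi_div_two_lt_arctan _).le, (Real.arctan_lt_pi_div_two _).le⟩)
  have he : ∫ x, Real.arctan (f x) ∂μ = ∫ x, Real.arctan (g x) ∂μ := by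
    rw [← integral_map hf.aemeasurable hat.aestronglyMeasurable, h,
      integral_map hg.aemeasurable hat.aestronglyMeasurable]
  have := (integral_eq_iff_of_ae_le (hint hf) (hint hg)
    (hle.mono fun x hx => Real.arctan_strictMono.monotone hx)).1 he
  exact this.mono fun x hx => Real.arctan_injective hx

/-- A real random variable can be refined to one without atoms by means of a diffuse map. -/
lemma exists_diffuse_refinement {Ω : Type*} [MeasurableSpace Ω] {μ : Measure Ω}
    [IsProbabilityMeasure μ] {ρ : Ω → ℝ} (hρ : Measurable ρ) {u : Ω → unitInterval}
    (hu : Measurable u) (hnull : ∀ c, μ (u ⁻¹' {c}) = 0) :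
    ∃ ζ : Ω → ℝ, Measurable ζ ∧ (∀ x y, ρ x < ρ y → ζ x < ζ y) ∧ ∀ c, μ (ζ ⁻¹' {c}) = 0 := by
  set m := μ.map ρ with hm
  have : IsProbabilityMeasure m := Measure.isProbabilityMeasure_map hρ.aemeasurable
  let F : ℝ → ℝ := fun a => m.real (Set.Iio a)
  let J : ℝ → ℝ := fun a => m.real {a}
  have hF : Monotone F := fun a b hab => measureReal_mono (Set.Iio_subset_Iio hab)
  have hFJ : ∀ a, F a + J a = m.real (Set.Iic a) := fun a => by
    rw [← Set.Iio_union_right, measureReal_union (by simp) (measurableSet_singleton a)]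
  have hIic : Monotone fun a => m.real (Set.Iic a) :=
    fun a b hab => measureReal_mono (Set.Iic_subset_Iic.2 hab)
  have hJm : Measurable J := by
    have : J = fun a => m.real (Set.Iic a) - F a := by
      ext a
      rw [← hFJ]
      ring
    rw [this]
    exact hIic.measurable.sub hF.measurable
  have hlt : ∀ x y, ρ x < ρ y →
      ρ x + F (ρ x) + J (ρ x) * u x < ρ y + F (ρ y) + J (ρ y) * u y := by
    intro x y hxy
    have h1 : J (ρ x) * u x ≤ J (ρ x) :=
      mul_le_of_le_one_right measureReal_nonneg (u x).2.2
    have h2 : 0 ≤ J (ρ y) * u y := mul_nonneg measureReal_nonneg (u y).2.1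
    have h3 : F (ρ x) + J (ρ x) ≤ F (ρ y) := by
      rw [hFJ]
      exact measureReal_mono (Set.Iic_subset_Iio.2 hxy)
    linarith
  -- An atom of the law of `ρ` at `a` is spread by `u` over an interval of length `J a`, for which
  -- `F` makes room. The summand `ρ x` keeps the order strict where the law has no mass. A level set
  -- of `ζ` lies in one fibre of `ρ`, and if that fibre has positive measure, `u` is constant on the
  -- level set.
  refine ⟨fun x => ρ x + F (ρ x) + J (ρ x) * u x, ?_, hlt, fun c => ?_⟩
  · have := hF.measurable
    fun_prop
  · set S := (fun x => ρ x + F (ρ x) + J (ρ x) * (u x : ℝ)) ⁻¹' {c}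
    rcases S.eq_empty_or_nonempty with hS | ⟨x, hx⟩
    · rw [hS, measure_empty]
    · have hx : ρ x + F (ρ x) + J (ρ x) * u x = c := hx
      have hsub : ∀ y ∈ S, ρ y = ρ x ∧ J (ρ x) * u y = J (ρ x) * u x := by
        intro y (hy : ρ y + F (ρ y) + J (ρ y) * u y = c)
        have hρ : ρ y = ρ x := by
          rcases lt_trichotomy (ρ y) (ρ x) with h | h | h
          · exact absurd (hlt _ _ h) (by rw [hx, hy]; exact lt_irrefl _)
          · exact h
          · exact absurd (hlt _ _ h) (by rw [hx, hy]; exact lt_irrefl _)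
        refine ⟨hρ, ?_⟩
        rw [hρ] at hy
        linarith
      by_cases hJ : J (ρ x) = 0
      · refine measure_mono_null (t := ρ ⁻¹' {ρ x}) (fun y hy => (hsub y hy).1) ?_
        rw [← Measure.map_apply hρ (measurableSet_singleton _)]
        exact (measureReal_eq_zero_iff).1 hJ
      · exact measure_mono_null (t := u ⁻¹' {u x})
          (fun y hy => Subtype.ext (mul_left_cancel₀ hJ (hsub y hy).2)) (hnull _)

/-- On an atomless probability space every real random variable is a.e. the quantile function of
its law, evaluated at a uniform random variable. -/
theorem IsAtomless.exists_uniform {Ω : Type*} [MeasurableSpace Ω] {μ : Measure Ω}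
    [IsProbabilityMeasure μ] (h : IsAtomless μ) {ρ : Ω → ℝ} (hρ : Measurable ρ) :
    ∃ χ : Ω → unitInterval, MeasurePreserving χ μ volume ∧ ρ =ᵐ[μ] quantile (μ.map ρ) ∘ χ := by
  obtain ⟨u, hu, hnull⟩ := h.exists_diffuse
  obtain ⟨ζ, hζ, hlt, hζ0⟩ := exists_diffuse_refinement hρ hu hnull
  have : IsProbabilityMeasure (μ.map ρ) := Measure.isProbabilityMeasure_map hρ.aemeasurable
  have : IsProbabilityMeasure (μ.map ζ) := Measure.isProbabilityMeasure_map hζ.aemeasurable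
  have hχ : MeasurePreserving (unitCdf (μ.map ζ) ∘ ζ) μ volume :=
    (measurePreserving_unitCdf fun a => by
      rw [Measure.map_apply hζ (measurableSet_singleton a), hζ0]).comp (hζ.measurePreserving μ)
  refine ⟨_, hχ, (ae_eq_of_ae_le_of_map_eq (measurable_quantile.comp hχ.measurable) hρ ?_
    (measurePreserving_quantile.comp hχ).map_eq).symm⟩
  -- Since `ζ` refines the order of `ρ`, the event `ζ y ≤ ζ x` implies `ρ y ≤ ρ x`. So `χ x` is at
  -- most the distribution function of `ρ` at `ρ x`, which is the required inequality; equality of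
  -- laws does the rest.
  filter_upwards [hχ.quasiMeasurePreserving.ae ae_mem_Ioo_unitInterval] with x hx
  refine (quantile_le_iff hx _).2 ?_
  simp only [Function.comp_apply, unitCdf]
  rw [cdf_eq_real, cdf_eq_real, map_measureReal_apply hζ measurableSet_Iic,
    map_measureReal_apply hρ measurableSet_Iic]
  exact measureReal_mono fun y (hy : ζ y ≤ ζ x) => not_lt.1 fun h => not_lt.2 hy (hlt _ _ h)

/-- On atomless spaces, a common kernel on a standard Borel space may be replaced by one on the
unit interval. -/
theorem ArePullbacksOfKernelOn.unitInterval {Ω₁ Ω₂ Ω : Type*} [MeasurableSpace Ω₁]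
    [MeasurableSpace Ω₂] [MeasurableSpace Ω] [StandardBorelSpace Ω] {μ₁ : Measure Ω₁}
    {μ₂ : Measure Ω₂} [IsProbabilityMeasure μ₁] [IsProbabilityMeasure μ₂] {μ : Measure Ω}
    [IsProbabilityMeasure μ] {W₁ : Ω₁ × Ω₁ → ℝ} {W₂ : Ω₂ × Ω₂ → ℝ}
    (h : ArePullbacksOfKernelOn μ₁ μ₂ W₁ W₂ μ) (h₁ : IsAtomless μ₁) (h₂ : IsAtomless μ₂) :
    ArePullbacksOfKernelOn μ₁ μ₂ W₁ W₂ (volume : Measure unitInterval) := by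
  obtain ⟨W, φ₁, φ₂, hW, p₁, p₂, e₁, e₂⟩ := h
  have hne : Nonempty Ω := μ.nonempty_of_neZero
  have hι := measurableEmbedding_embeddingReal Ω
  -- A measurable left inverse of the embedding, to return from the quantile function to `Ω`.
  obtain ⟨r, hr, hrι⟩ := hι.exists_measurable_extend measurable_id fun _ => hne
  have : IsProbabilityMeasure (μ.map (embeddingReal Ω)) :=
    Measure.isProbabilityMeasure_map hι.measurable.aemeasurable
  have pι : MeasurePreserving (embeddingReal Ω) μ (μ.map (embeddingReal Ω)) :=
    hι.measurable.measurePreserving μ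
  have hr' : MeasurePreserving r (μ.map (embeddingReal Ω)) μ :=
    ⟨hr, by rw [Measure.map_map hr hι.measurable, hrι, Measure.map_id]⟩
  obtain ⟨χ₁, hχ₁, q₁⟩ := h₁.exists_uniform (pι.comp p₁).measurable
  obtain ⟨χ₂, hχ₂, q₂⟩ := h₂.exists_uniform (pι.comp p₂).measurable
  rw [(pι.comp p₁).map_eq] at q₁
  rw [(pι.comp p₂).map_eq] at q₂
  refine ArePullbacksOfKernelOn.of_factor hW e₁ e₂ (hr'.comp measurePreserving_quantile) hχ₁ hχ₂
    (q₁.mono fun x hx => ?_) (q₂.mono fun x hx => ?_)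
  · exact (congrFun hrι (φ₁ x)).symm.trans (congrArg r hx)
  · exact (congrFun hrι (φ₂ x)).symm.trans (congrArg r hx)

end Quantile

end CutMetric

end

theorem theorem8p2 {Ω₁ : Type u} {Ω₂ : Type v} [MeasurableSpace Ω₁] [MeasurableSpace Ω₂]
    (μ₁ : Measure Ω₁) (μ₂ : Measure Ω₂) [IsProbabilityMeasure μ₁] [IsProbabilityMeasure μ₂]
    (W₁ : Ω₁ × Ω₁ → ℝ) (W₂ : Ω₂ × Ω₂ → ℝ)
    (hW₁ : CutMetric.IsKernel μ₁ W₁) (hW₂ : CutMetric.IsKernel μ₂ W₂)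
    (ver : CutMetric.CutNormVersion) :
    (CutMetric.cutDist.{u, v, t} ver μ₁ μ₂ W₁ W₂ = 0 ↔
      ∃ (Ω : Type w) (_ : MeasurableSpace Ω) (μ : Measure Ω), IsProbabilityMeasure μ ∧
        CutMetric.ArePullbacksOfKernelOn μ₁ μ₂ W₁ W₂ μ) ∧
    (CutMetric.cutDist.{u, v, t} ver μ₁ μ₂ W₁ W₂ = 0 →
      ∃ (Ω : Type w) (_ : MeasurableSpace Ω) (μ : Measure Ω), IsProbabilityMeasure μ ∧
        StandardBorelSpace Ω ∧ CutMetric.ArePullbacksOfKernelOn μ₁ μ₂ W₁ W₂ μ) ∧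
    (CutMetric.cutDist.{u, v, t} ver μ₁ μ₂ W₁ W₂ = 0 →
      CutMetric.IsAtomless μ₁ → CutMetric.IsAtomless μ₂ →
        CutMetric.ArePullbacksOfKernelOn μ₁ μ₂ W₁ W₂ (volume : Measure unitInterval)) := by
  refine ⟨⟨fun h => ?_, ?_⟩, fun h => ?_, fun h h₁ h₂ => ?_⟩
  · obtain ⟨Ω, _, μ, hμ, -, hp⟩ :=
      CutMetric.exists_standardBorel_of_cutDist_eq_zero.{u, v, t, w} hW₁ hW₂ h
    exact ⟨Ω, _, μ, hμ, hp⟩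
  · rintro ⟨Ω, _, μ, _, hp⟩
    exact hp.cutDist_eq_zero hW₁ hW₂ ver
  · exact CutMetric.exists_standardBorel_of_cutDist_eq_zero hW₁ hW₂ h
  · obtain ⟨Ω, _, μ, _, _, hp⟩ :=
      CutMetric.exists_standardBorel_of_cutDist_eq_zero.{u, v, t, 0} hW₁ hW₂ h
    exact hp.unitInterval h₁ h₂
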